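/- **Theorem (cosystolic expansion for cube complexes).** For every integer $k\ge 0$ there exist constants $K,K'\in(0,1]$, depending only on $k$, such that the following holds. Let $R$ be a commutative ring, let $d\ge k+2$, let $(X,w)$ be a properly weighted finite pure $d$-dimensional cube complex with a fixed $R$-orientation, let $\mathcal F$ be an $R$-sheaf on $X$, let $\varepsilon\in(0,1]$ and $B'\in[1,\infty)$. Suppose that * (1a) $\mathrm{cbe}_{k-\dim u-1}(X_u,w_u,\mathcal F_u)\ge\varepsilon$ for every $u\in X(0)\cup\dots\cup X(k)$; * (1b) $\mathrm{cbe}_{k-\dim u}(X_u,w_u,\mathcal F_u)\ge\varepsilon$ for every $u\in X(0)\cup\dots\cup X(k+1)$; * (2△) for every $u\in X(-1)\cup\dots\cup X(k)$, the underlying weighted graph of $(X_u,w_u)$ (its $0$- and $1$-faces, with distinct adjacent vertices being related) is a $((K\varepsilon)^{2^{k-\dim u}},1)$-skeleton expander; * (2□) for every $i\in\{1,\dots,k+1\}$, $\mathrm{NI}^{i,i,i+1}(X,w)$ is a $((K\varepsilon)^{2^{k+1-i}},\,B'(K\varepsilon)^{-2^{k+2-i}(2^i-1)})$-skeleton expander.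 Then $$\mathrm{cse}_k(X,w,\mathcal F)\ \ge\ B'^{-1}K'(K\varepsilon)^{2^{k+2}-1}.$$ If, moreover, * (2□′) for every $i\in\{1,\dots,k\}$, $\mathrm{NI}^{i,i,i+1}(X,w)$ is a $((K\varepsilon)^{2^{k+1-i}},\,B'(K\varepsilon)^{-2^{k+1-i}(2^i-1)})$-skeleton expander, then also $$\mathrm{ccd}_k(X,w,\mathcal F)\ \ge\ B'^{-1}K'(K\varepsilon)^{2^{k+1}-1}.$$ (If the condition in (2□′) holds for all $i\in\{1,\dots,k+1\}$, then it implies (2□), so both bounds hold.) Finally, under (1a), (1b), (2△), (2□), let $f\in C^k(X,\mathcal F)$ satisfy $\mathrm{dist}_w(f,Z^k)<B'^{-1}K'(K\varepsilon)^{2^{k+2}-1}$ and put $q=K(K\varepsilon)^{2^{k+1}-1}$. Consider the algorithm which starts with $f_0=f$ and, as long as there are $u\in X(0)\cup\dots\cup X(k)$ and $g\in C^{k-\dim u-1}(X_u,\mathcal F_u)$ with $\|df_i+d(g^u)\|_w<\|df_i\|_w-q\,w(u)$, picks such a pair and puts $f_{i+1}=f_i+g^u$, and otherwise returns $f_i$.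 Whatever choices are made, it stops and returns some $f'\in Z^k$ with $\mathrm{dist}_w(f,f')\le K'^{-1}(K\varepsilon)^{-2^{k+1}}\,\mathrm{dist}_w(f,Z^k)$. *Definitions.* A cube complex is the face poset of a finite regular cell complex whose cells are cubes, including an empty face $\emptyset$ of dimension $-1$ (equivalently, a finite graded poset with least element $\emptyset$ of dimension $-1$ in which the faces of each $n$-face, $n\ge0$, form the face poset of $[0,1]^n$). $X(i)$ is the set of $i$-faces; $X$ is pure $d$-dimensional if every face lies in a $d$-face. A proper weight is $w:X\to(0,\infty)$ with $w(X(d))=1$ and $w(x)=\sum_{y\in X(d),\,y\ge x}w(y)/\#\{x'\in X(\dim x): x'\le y\}$. The link is $X_u=\{x\ge u\}$ with $\dim_{X_u}x=\dim x-\dim u-1$, with induced weight $w_u(x)=\frac{1}{w(\{y\in X(d):y\ge u\})}\sum_{y\in X(d),\,y\ge x}w(y)/\#\{x'\in X(\dim x):u\le x'\le y\}$ and with the restricted orientation and sheaf $\mathcal F_u$. An $R$-orientation assigns $[y:x]\in R^\times$ to each covering pair $x\lhd y$ so that $\sum_{x<y<z}[z:y][y:x]=0$ whenever $x\le z$ and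 $\dim z=\dim x+2$. An $R$-sheaf assigns to each $x$ an $R$-module $\mathcal F(x)$ and to $x\le y$ an $R$-linear restriction map $\mathrm{res}_{y\leftarrow x}$, functorially. $C^i=\prod_{x\in X(i)}\mathcal F(x)$, $(df)(y)=\sum_{x\le y,\,x\in X(i)}[y:x]\,\mathrm{res}_{y\leftarrow x}f(x)$, $Z^i=\ker d_i$, $B^i=\operatorname{im}d_{i-1}$; $\|f\|_w=w(\operatorname{supp}f)$, $\mathrm{dist}_w(f,g)=\|f-g\|_w$; $g^u$ is the extension of $g$ by $0$. $\mathrm{cse}_i$ (resp. $\mathrm{cbe}_i$) is the supremum of the $\mu\in[0,\infty)$ with $\|df\|_w\ge\mu\,\mathrm{dist}_w(f,Z^i)$ (resp. $\ge\mu\,\mathrm{dist}_w(f,B^i)$) for all $f\in C^i$, and $\mathrm{ccd}_i=\inf\{\|f\|_w: f\in Z^i\setminus B^i\}$ (values in $[0,\infty]$). $\mathrm{NI}^{i,i,i+1}(X,w)$ is the hypergraph with vertices $X(i)$, hyperedges $X(i+1)$, incidence $\le$ and weights $w$, in which $x,y\in X(i)$ are related if they lie in a common $(i+1)$-face and $\emptyset$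 is the only maximal lower bound of $\{x,y\}$ (for $i\ge 1$: opposite faces of an $(i+1)$-cube). A weighted hypergraph with a relation on its vertices is an $(\alpha,\beta)$-skeleton expander if for each set $A$ of vertices, the total weight of the hyperedges containing two distinct related vertices of $A$ is at most $\alpha w(A)+\beta w(A)^2$. -/

import Mathlib

universe uR uX uM

open scoped ENNReal NNReal

/-! Graded posets with an empty face.  A graded poset is a finite partial order with a
`GradeOrder ℤ` structure; the grade of a face is its dimension. -/

section Poset

variable {X : Type uX} [PartialOrder X]

/-- The dimension of a face. -/
noncomputable def fdim [GradeOrder ℤ X] (x : X) : ℤ := grade ℤ x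

/-- `X(i)`, the type of `i`-faces. -/
abbrev Face (X : Type uX) [PartialOrder X] [GradeOrder ℤ X] (i : ℤ) : Type uX :=
  {x : X // fdim x = i}

/-- The set of infima (maximal lower bounds) of `A`. -/
def infima (A : Set X) : Set X := {m | Maximal (fun b => b ∈ lowerBounds A) m}

/-- The link `X_z = {x | z ≤ x}`, with the order of `X`. -/
@[ext] structure Link (z : X) where
  face : X
  le_face : z ≤ face

instance (z : X) : PartialOrder (Link z) :=
  PartialOrder.lift Link.face fun _ _ h => Link.ext h

instance (z : X) : OrderBot (Link z) where
  bot := ⟨z, le_rfl⟩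
  bot_le x := x.le_face

noncomputable instance [Fintype X] (z : X) : Fintype (Link z) :=
  Fintype.ofInjective Link.face fun _ _ h => Link.ext h

/-- The dimension in the link is `dim x - dim z - 1`. -/
noncomputable instance [GradeOrder ℤ X] (z : X) : GradeOrder ℤ (Link z) where
  grade x := fdim x.face - fdim z - 1
  grade_strictMono := fun a b h => by
    have h2 : fdim a.face < fdim b.face :=
      grade_strictMono (𝕆 := ℤ) (show a.face < b.face from h)
    show fdim a.face - fdim z - 1 < fdim b.face - fdim z - 1
    omega
  covBy_grade := fun a b h => by
    have h1 : a.face ⋖ b.face :=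
      ⟨h.1, fun c hac hcb => h.2 (c := ⟨c, a.le_face.trans hac.le⟩) hac hcb⟩
    have h2 : fdim a.face ⋖ fdim b.face := GradeOrder.covBy_grade h1
    rw [Order.covBy_iff_add_one_eq] at h2 ⊢
    omega

theorem fdim_link [GradeOrder ℤ X] {z : X} (x : Link z) :
    fdim x = fdim x.face - fdim z - 1 := rfl

/-- `X` is pure of dimension `d`: it is nonempty and every face lies in a `d`-face. -/
def IsPure (X : Type uX) [PartialOrder X] [GradeOrder ℤ X] (d : ℕ) : Prop :=
  Nonempty X ∧ ∀ x : X, ∃ y : X, fdim y = d ∧ x ≤ y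

/-! Cube complexes. -/

/-- The faces of the cube `[0,1]^n`, including the empty face, each one identified with its set
of vertices and ordered by inclusion.  A nonempty face is cut out by prescribing some of the
coordinates. -/
def CubeFace (n : ℕ) : Type :=
  {S : Set (Fin n → Bool) //
    S = ∅ ∨ ∃ p : Fin n → Option Bool, S = {v | ∀ i b, p i = some b → v i = b}}

instance (n : ℕ) : PartialOrder (CubeFace n) :=
  inferInstanceAs (PartialOrder {S : Set (Fin n → Bool) //
    S = ∅ ∨ ∃ p : Fin n → Option Bool, S = {v | ∀ i b, p i = some b → v i = b}})

/-- `X` is the face poset of a cube complex (a regular cell complex all of whose cells are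
cubes): the empty face `⊥` has dimension `-1`, and the faces of every nonempty face `x` form
the face poset of a cube of dimension `dim x`. -/
def IsCubeComplex (X : Type uX) [PartialOrder X] [OrderBot X] [GradeOrder ℤ X] : Prop :=
  fdim (⊥ : X) = -1 ∧
    ∀ x : X, x ≠ ⊥ → ∃ n : ℕ, fdim x = n ∧ Nonempty (Set.Iic x ≃o CubeFace n)

/-! Weights. -/

open Classical in
/-- The total weight `w(A)`. -/
noncomputable def weightOf {V : Type*} [Fintype V] (w : V → ℝ) (A : Set V) : ℝ :=
  ∑ x, if x ∈ A then w x else 0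

/-- `w` is a proper weight function on the poset `X`, which is pure of dimension `d`. -/
structure IsProperWeight [Fintype X] [GradeOrder ℤ X] (d : ℕ) (w : X → ℝ) : Prop where
  pure : IsPure X d
  pos : ∀ x, 0 < w x
  total : weightOf w {y | fdim y = d} = 1
  proper : ∀ x, w x = weightOf
    (fun y => w y / (Set.ncard {x' : X | fdim x' = fdim x ∧ x' ≤ y} : ℝ))
    {y | fdim y = d ∧ x ≤ y}

/-- The weight function `w_z` induced by `w` on the link `X_z`. -/
noncomputable def linkWeight [Fintype X] [GradeOrder ℤ X] (d : ℕ) (w : X → ℝ) (z : X) :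
    Link z → ℝ := fun x =>
  (weightOf w {y | fdim y = d ∧ z ≤ y})⁻¹ *
    weightOf
      (fun y => w y / (Set.ncard {x' : X | fdim x' = fdim x.face ∧ z ≤ x' ∧ x' ≤ y} : ℝ))
      {y | fdim y = d ∧ x.face ≤ y}

end Poset

/-! Related weighted hypergraphs and skeleton expansion. -/

/-- A finite weighted hypergraph with a relation on its vertices such that related vertices lie
in a common hyperedge. -/
structure RelHypergraph where
  V : Type uX
  E : Type uX
  [fintypeV : Fintype V]
  [fintypeE : Fintype E]
  inc : V → E → Prop
  wV : V → ℝ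
  wE : E → ℝ
  rel : V → V → Prop
  rel_inc : ∀ u v, rel u v → ∃ e, inc u e ∧ inc v e

attribute [instance] RelHypergraph.fintypeV RelHypergraph.fintypeE

/-- The hyperedges containing two distinct related vertices of `A`. -/
def RelHypergraph.E2 (H : RelHypergraph.{uX}) (A : Set H.V) : Set H.E :=
  {e | ∃ u ∈ A, ∃ v ∈ A, u ≠ v ∧ H.inc u e ∧ H.inc v e ∧ H.rel u v}

/-- `(α, β)`-skeleton expansion. -/
def RelHypergraph.IsSkeletonExpander (H : RelHypergraph.{uX}) (α β : ℝ) : Prop :=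
  ∀ A : Set H.V,
    weightOf H.wE (H.E2 A) ≤ α * weightOf H.wV A + β * weightOf H.wV A ^ 2

section Hypergraphs

variable {X : Type uX} [PartialOrder X] [Fintype X] [GradeOrder ℤ X]

/-- The underlying weighted hypergraph of `(X, w)`, formed by the `0`-faces and the `1`-faces,
with the standard relation. -/
noncomputable def underlyingGraph (w : X → ℝ) : RelHypergraph.{uX} where
  V := Face X 0
  E := Face X 1
  inc x e := x.1 ≤ e.1
  wV x := w x.1
  wE e := w e.1
  rel x y := x ≠ y ∧ ∃ e : Face X 1, x.1 ≤ e.1 ∧ y.1 ≤ e.1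
  rel_inc _ _ h := h.2

/-- The `(i, j, k)`-no-intersection related hypergraph of `(X, w)`. -/
noncomputable def noIntersection [OrderBot X] (i j k : ℤ) (w : X → ℝ) :
    RelHypergraph.{uX} where
  V := {x : X // fdim x = i ∨ fdim x = j}
  E := Face X k
  inc x z := x.1 ≤ z.1
  wV x := if i = j then w x.1 else w x.1 / 2
  wE z := w z.1
  rel x y := (∃ z : Face X k, x.1 ≤ z.1 ∧ y.1 ≤ z.1) ∧ infima {x.1, y.1} = {⊥} ∧
    ((fdim x.1 = i ∧ fdim y.1 = j) ∨ (fdim x.1 = j ∧ fdim y.1 = i))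
  rel_inc _ _ h := h.1

end Hypergraphs

/-! Orientations, sheaves, cochains. -/

open Classical in
/-- An `R`-orientation `[y : x]`, written `sgn y x`.  Only the values with `x ⋖ y` are
meaningful. -/
structure POrientation (R : Type uR) [CommRing R] (X : Type uX) [PartialOrder X] [Fintype X]
    [GradeOrder ℤ X] where
  sgn : X → X → Rˣ
  sum_eq_zero : ∀ x z : X, x ≤ z → fdim z = fdim x + 2 →
    ∑ y : X, (if x < y ∧ y < z then ((sgn z y : R) * (sgn y x : R)) else 0) = 0

/-- An `R`-sheaf on a poset. -/
structure PosetSheaf (R : Type uR) [CommRing R] (X : Type uX) [PartialOrder X] where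
  obj : X → Type uM
  [addCommGroup : ∀ x, AddCommGroup (obj x)]
  [module : ∀ x, Module R (obj x)]
  res : ∀ {x y : X}, x ≤ y → obj x →ₗ[R] obj y
  res_refl : ∀ x : X, res (le_refl x) = LinearMap.id
  res_comp : ∀ {x y z : X} (hxy : x ≤ y) (hyz : y ≤ z),
    res hyz ∘ₗ res hxy = res (hxy.trans hyz)

attribute [instance] PosetSheaf.addCommGroup PosetSheaf.module

section Sheaves

variable {R : Type uR} [CommRing R] {X : Type uX} [PartialOrder X]

/-- The orientation of the link inherited from `X`. -/
def POrientation.link [Fintype X] [GradeOrder ℤ X] (o : POrientation R X) (z : X) :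
    POrientation R (Link z) where
  sgn y x := o.sgn y.face x.face
  sum_eq_zero := by
    classical
    intro a c hac hdim
    have hdim' : fdim c.face = fdim a.face + 2 := by
      rw [fdim_link, fdim_link] at hdim
      omega
    refine Eq.trans ?_ (o.sum_eq_zero a.face c.face hac hdim')
    refine Finset.sum_bij_ne_zero (fun (y : Link z) _ _ => y.face)
      (fun _ _ _ => Finset.mem_univ _) (fun _ _ _ _ _ _ h => Link.ext h) ?_ ?_
    · intro b _ hb
      have hb1 : a.face < b ∧ b < c.face := by
        by_contra hcon
        exact hb (if_neg hcon)
      refine ⟨⟨b, a.le_face.trans hb1.1.le⟩, Finset.mem_univ _, ?_, rfl⟩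
      intro h0
      apply hb
      refine Eq.trans ?_ h0
      exact if_congr Iff.rfl rfl rfl
    · intro y _ _
      exact if_congr Iff.rfl rfl rfl

/-- The restriction `F_z` of a sheaf to the link `X_z`. -/
def PosetSheaf.link (F : PosetSheaf.{uR, uX, uM} R X) (z : X) :
    PosetSheaf.{uR, uX, uM} R (Link z) where
  obj x := F.obj x.face
  res {x y} h := F.res (x := x.face) (y := y.face) h
  res_refl x := F.res_refl x.face
  res_comp hxy hyz := F.res_comp (x := _) (y := _) (z := _) hxy hyz

variable [Fintype X] [GradeOrder ℤ X]

/-- The `i`-cochains `C^i(X, F)`. -/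
abbrev Cochain (F : PosetSheaf.{uR, uX, uM} R X) (i : ℤ) : Type (max uX uM) :=
  ∀ x : Face X i, F.obj x.1

open Classical in
/-- The coboundary map `(d f)(y) = ∑_{x ∈ y(i)} [y : x] res_{y ← x} f(x)`, used for
`j = i + 1`. -/
noncomputable def coboundary (o : POrientation R X) (F : PosetSheaf.{uR, uX, uM} R X)
    (i j : ℤ) : Cochain F i →ₗ[R] Cochain F j :=
  LinearMap.pi fun y => ∑ x : Face X i,
    if h : x.1 ≤ y.1 then
      (o.sgn y.1 x.1 : R) • (F.res h ∘ₗ (LinearMap.proj x : Cochain F i →ₗ[R] F.obj x.1))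
    else 0

/-- The `i`-cocycles `Z^i(X, F)`. -/
noncomputable def cocycles (o : POrientation R X) (F : PosetSheaf.{uR, uX, uM} R X) (i : ℤ) :
    Submodule R (Cochain F i) :=
  LinearMap.ker (coboundary o F i (i + 1))

/-- The `i`-coboundaries `B^i(X, F)`. -/
noncomputable def coboundaries (o : POrientation R X) (F : PosetSheaf.{uR, uX, uM} R X)
    (i : ℤ) : Submodule R (Cochain F i) :=
  LinearMap.range (coboundary o F (i - 1) i)

/-- `‖f‖_w = w(supp f)`. -/
noncomputable def cnorm (w : X → ℝ) {F : PosetSheaf.{uR, uX, uM} R X} {i : ℤ}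
    (f : Cochain F i) : ℝ :=
  weightOf (fun x : Face X i => w x.1) {x | f x ≠ 0}

/-- `dist_w(f, S)`, the least `‖f - g‖_w` with `g ∈ S`. -/
noncomputable def cdist (w : X → ℝ) {F : PosetSheaf.{uR, uX, uM} R X} {i : ℤ}
    (f : Cochain F i) (S : Submodule R (Cochain F i)) : ℝ :=
  ⨅ g : S, cnorm w (f - g.1)

/-- The `i`-cosystolic expansion, a supremum in `[0, ∞]`. -/
noncomputable def cse (i : ℤ) (w : X → ℝ) (o : POrientation R X)
    (F : PosetSheaf.{uR, uX, uM} R X) : ℝ≥0∞ :=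
  sSup ((fun μ : ℝ≥0 => (μ : ℝ≥0∞)) '' {μ : ℝ≥0 | ∀ f : Cochain F i,
    (μ : ℝ) * cdist w f (cocycles o F i) ≤ cnorm w (coboundary o F i (i + 1) f)})

/-- The `i`-coboundary expansion, a supremum in `[0, ∞]`. -/
noncomputable def cbe (i : ℤ) (w : X → ℝ) (o : POrientation R X)
    (F : PosetSheaf.{uR, uX, uM} R X) : ℝ≥0∞ :=
  sSup ((fun μ : ℝ≥0 => (μ : ℝ≥0∞)) '' {μ : ℝ≥0 | ∀ f : Cochain F i,
    (μ : ℝ) * cdist w f (coboundaries o F i) ≤ cnorm w (coboundary o F i (i + 1) f)})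

/-- The `i`-cocycle distance, an infimum in `[0, ∞]` (so `∞` when `Z^i = B^i`). -/
noncomputable def ccd (i : ℤ) (w : X → ℝ) (o : POrientation R X)
    (F : PosetSheaf.{uR, uX, uM} R X) : ℝ≥0∞ :=
  sInf {r | ∃ f ∈ cocycles o F i, f ∉ coboundaries o F i ∧ r = ENNReal.ofReal (cnorm w f)}

open Classical in
/-- The extension by zero `g^u ∈ C^i(X, F)` of a cochain `g` on the link of `u`. -/
noncomputable def extendLink {F : PosetSheaf.{uR, uX, uM} R X} {i : ℤ} (u : X)
    (g : Cochain (F.link u) (i - fdim u - 1)) : Cochain F i := fun x =>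
  if h : u ≤ x.1 then g ⟨⟨x.1, h⟩, by rw [fdim_link, x.2]⟩ else 0

/-- One round of the correction algorithm with parameter `q`: `f' = f + g^u` for some face `u`
with `0 ≤ dim u ≤ k` and some cochain `g ∈ C^{k - dim u - 1}(X_u, F_u)` such that
`‖d f + d (g^u)‖ < ‖d f‖ - q w(u)`. -/
def CorrectionStep (w : X → ℝ) (o : POrientation R X) (F : PosetSheaf.{uR, uX, uM} R X)
    (k : ℤ) (q : ℝ) (f f' : Cochain F k) : Prop :=
  ∃ u : X, 0 ≤ fdim u ∧ fdim u ≤ k ∧ ∃ g : Cochain (F.link u) (k - fdim u - 1),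
    cnorm w (coboundary o F k (k + 1) f + coboundary o F k (k + 1) (extendLink u g)) <
        cnorm w (coboundary o F k (k + 1) f) - q * w u ∧
      f' = f + extendLink u g

/-- The algorithm, started at `f`, stops after finitely many rounds, whatever choices are
made. -/
def CorrectionStops (w : X → ℝ) (o : POrientation R X) (F : PosetSheaf.{uR, uX, uM} R X)
    (k : ℤ) (q : ℝ) (f : Cochain F k) : Prop :=
  Acc (fun b a => CorrectionStep w o F k q a b) f

/-- `f'` is a possible output of the algorithm started at `f`: it is reached by finitely many
rounds, and no further round is possible. -/
def CorrectionReturns (w : X → ℝ) (o : POrientation R X) (F : PosetSheaf.{uR, uX, uM} R X)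
    (k : ℤ) (q : ℝ) (f f' : Cochain F k) : Prop :=
  Relation.ReflTransGen (CorrectionStep w o F k q) f f' ∧
    ¬ ∃ f'', CorrectionStep w o F k q f' f''

end Sheaves

/-! Everything reduces to `eq_zero_of_locally_minimal`: an m-cocycle f of small norm vanishes if, up
to an error q w(u), its norm cannot be lowered by a coboundary of a cochain supported above a single
nonempty face u. The algorithm stops because ‖df_i‖ decreases and takes finitely many values. For an
output f', the cocycle df' is locally minimal, hence zero if ‖df‖ is small (case m = k + 1). A round
moves f by O(w(u)) and lowers ‖df‖ by more than q w(u), so in total f moves by O(‖df‖/q). This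
yields the bound on `cse` and the claim about the algorithm. The bound on `ccd` is the case m = k, q
= 0, applied to a representative of least norm in a cohomology class.

To prove the vanishing, put t = Kε and A 0 = supp f. A face of dimension m - s - 1 is heavy, i.e. in
A (s + 1), if a proportion at least t^(2^s) of the (m - s)-faces above it, by weight, is in A s.
Then t^(2^s - 1) w(A s) ≤ ‖f‖, and smallness of ‖f‖ prevents ∅ from being heavy, so descending
chains of heavy faces stop at nonempty terminal faces u. Let f_u be the part of f on the faces
having a chain to u.

Two facets of a cube are opposite or meet in codimension two (`IsCubeComplex.facets_meet`). An (m +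
1)-face is bad if some face below it has two facets in the same A s that are opposite, or that meet
in a facet outside A (s + 1). Below a face that is not bad, all of supp f reaches the same terminal
faces (`HeavyPath.of_terminal`), so d f_u is there either df = 0 or trivially zero. Hence d f_u
lives on bad faces above u. Expansion of the graphs of links and of the no-intersection hypergraphs
shows that the bad faces weigh O(t‖f‖) (`weightOf_badFaces`).

Finally, coboundary expansion in the link of u and local minimality give ε(‖f_u‖ - q w(u)) = O(‖d
f_u‖) (`cnorm_cutoff_le`). Summing over u gives ε‖f‖ ≤ ε‖f‖/2 + O(Kε‖f‖), which forces f = 0 for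
small K. -/

/-! ### The face poset of a cube in coordinates -/

/-- The coordinates left free by a pattern. -/
def freeCoords {n : ℕ} (p : Fin n → Option Bool) : Finset (Fin n) :=
  Finset.univ.filter fun i => p i = none

/-- The nonempty face cut out by a pattern. -/
def patternFace {n : ℕ} (p : Fin n → Option Bool) : CubeFace n :=
  ⟨{v | ∀ i b, p i = some b → v i = b}, Or.inr ⟨p, rfl⟩⟩

/-- The empty face of a cube. -/
def emptyFace (n : ℕ) : CubeFace n := ⟨∅, Or.inl rfl⟩

theorem emptyFace_le {n : ℕ} (c : CubeFace n) : emptyFace n ≤ c :=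
  show (∅ : Set (Fin n → Bool)) ⊆ c.1 from Set.empty_subset _

theorem patternFace_nonempty {n : ℕ} (p : Fin n → Option Bool) : (patternFace p).1.Nonempty :=
  ⟨fun i => (p i).getD true, fun i b h => by simp [h]⟩

theorem patternFace_ne_empty {n : ℕ} (p : Fin n → Option Bool) : patternFace p ≠ emptyFace n :=
  fun h => (patternFace_nonempty p).ne_empty (congrArg Subtype.val h)

theorem patternFace_le_iff {n : ℕ} {p q : Fin n → Option Bool} :
    patternFace p ≤ patternFace q ↔ ∀ i b, q i = some b → p i = some b := by
  constructor
  · intro h i b hq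
    have h' : (patternFace p).1 ⊆ (patternFace q).1 := h
    -- This vertex of the face of p takes the wrong value `!b` wherever p leaves a coordinate free,
    -- so p must itself fix the coordinate i.
    have hv := h' (a := fun j => (p j).getD (!b)) (fun j c hc => by simp [hc]) i b hq
    cases hp : p i with
    | none => simp [hp] at hv
    | some c => simp [hp] at hv; rw [hv]
  · intro h
    show (patternFace p).1 ⊆ (patternFace q).1
    intro v hv i b hq
    exact hv i b (h i b hq)

theorem patternFace_injective {n : ℕ} :
    Function.Injective (patternFace : (Fin n → Option Bool) → CubeFace n) := by
  intro p q h
  have h1 := patternFace_le_iff.1 h.le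
  have h2 := patternFace_le_iff.1 h.ge
  funext i
  exact Option.ext fun b => ⟨h2 i b, h1 i b⟩

theorem cubeFace_cases {n : ℕ} (c : CubeFace n) : c = emptyFace n ∨ ∃ p, c = patternFace p := by
  obtain ⟨S, rfl | ⟨p, rfl⟩⟩ := c
  · exact Or.inl rfl
  · exact Or.inr ⟨p, rfl⟩

/-- In a graded poset it is the covering relations that determine dimensions: with
`emptyFace_covBy`, this makes the dimension of a face the number of its free coordinates. -/
theorem patternFace_covBy_update {n : ℕ} {p : Fin n → Option Bool} {i : Fin n}
    (hi : p i = none) (b : Bool) :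
    patternFace (Function.update p i (some b)) ⋖ patternFace p := by
  constructor
  · refine lt_of_le_of_ne (patternFace_le_iff.2 ?_) ?_
    · intro j c hj
      rw [Function.update_of_ne (by rintro rfl; simp [hi] at hj), hj]
    · intro h
      have := congrFun (patternFace_injective h) i
      simp [hi] at this
  · intro c h1 h2
    obtain rfl | ⟨q, rfl⟩ := cubeFace_cases c
    · exact (h1.trans_le (emptyFace_le _)).ne rfl
    have g1 := patternFace_le_iff.1 h1.le
    have g2 := patternFace_le_iff.1 h2.le
    have key : ∀ j, j ≠ i → q j = p j := by
      intro j hj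
      refine Option.ext fun c => ⟨fun h => ?_, g2 j c⟩
      have := g1 j c h
      rwa [Function.update_of_ne hj] at this
    cases hq : q i with
    | none =>
      refine h2.ne (congrArg patternFace (funext fun j => ?_))
      by_cases hj : j = i
      · rw [hj, hq, hi]
      · exact key j hj
    | some c =>
      refine h1.ne (congrArg patternFace (funext fun j => ?_))
      by_cases hj : j = i
      · have := g1 i c hq
        rw [hj, this, hq]
      · rw [Function.update_of_ne hj, key j hj]

theorem emptyFace_covBy {n : ℕ} {p : Fin n → Option Bool} (hp : freeCoords p = ∅) :
    emptyFace n ⋖ patternFace p := by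
  constructor
  · exact lt_of_le_of_ne (emptyFace_le _) (patternFace_ne_empty p).symm
  · intro c h1 h2
    obtain rfl | ⟨q, rfl⟩ := cubeFace_cases c
    · exact h1.ne rfl
    refine h2.ne (congrArg patternFace (funext fun i => ?_))
    have hpi : p i ≠ none := fun h => by
      have : i ∈ freeCoords p := by simp [freeCoords, h]
      simp [hp] at this
    obtain ⟨b, hb⟩ := Option.ne_none_iff_exists'.1 hpi
    rw [hb, patternFace_le_iff.1 h2.le i b hb]

/-- The faces of a cube, as patterns together with the empty face. -/
noncomputable def cubeFaceEquiv (n : ℕ) : Option (Fin n → Option Bool) ≃ CubeFace n :=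
  Equiv.ofBijective (fun c => c.elim (emptyFace n) patternFace) <| by
    constructor
    · rintro (_ | p) (_ | q) h
      · rfl
      · exact absurd h.symm (patternFace_ne_empty q)
      · exact absurd h (patternFace_ne_empty p)
      · exact congrArg some (patternFace_injective h)
    · intro c
      obtain rfl | ⟨p, rfl⟩ := cubeFace_cases c
      · exact ⟨none, rfl⟩
      · exact ⟨some p, rfl⟩

/-- The dimension of a face of a cube. -/
def patternDim {n : ℕ} (c : Option (Fin n → Option Bool)) : ℤ :=
  c.elim (-1) fun p => (freeCoords p).card

/-- The number of `i`-faces of the `n`-cube. -/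
noncomputable def cubeCount (n : ℕ) (i : ℤ) : ℕ :=
  Nat.card {c : Option (Fin n → Option Bool) // patternDim c = i}

theorem cubeCount_le (n : ℕ) (i : ℤ) : cubeCount n i ≤ 3 ^ n + 1 := by
  refine (Nat.card_le_card_of_injective _ Subtype.val_injective).trans ?_
  simp [Nat.card_eq_fintype_card]

/-- The number of `j`-faces of the `n`-cube containing a given `i`-face. -/
noncomputable def cubeUpCount (n : ℕ) (i j : ℤ) : ℕ :=
  if i = -1 then cubeCount n j else (n - i.toNat).choose (j.toNat - i.toNat)

/-- A larger face arises by freeing some of the fixed coordinates, and is determined by the set of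
those. -/
theorem card_patterns_above {n : ℕ} (p : Fin n → Option Bool) (j : ℕ) :
    Nat.card {q : Fin n → Option Bool // patternFace p ≤ patternFace q ∧
      (freeCoords q).card = (freeCoords p).card + j} = (n - (freeCoords p).card).choose j := by
  classical
  have h0 : (n - (freeCoords p).card).choose j =
      (Finset.powersetCard j (freeCoords p)ᶜ).card := by
    rw [Finset.card_powersetCard, Finset.card_compl, Fintype.card_fin]
  rw [h0, Nat.card_eq_fintype_card, Fintype.card_subtype]
  have hsub : ∀ q, patternFace p ≤ patternFace q → freeCoords p ⊆ freeCoords q := by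
    intro q hq i hi
    simp only [freeCoords, Finset.mem_filter, Finset.mem_univ, true_and] at hi ⊢
    refine Option.eq_none_iff_forall_ne_some.2 fun b hb => ?_
    have := patternFace_le_iff.1 hq i b hb
    simp [hi] at this
  have hfree : ∀ T : Finset (Fin n), T ⊆ (freeCoords p)ᶜ →
      freeCoords (fun i => if i ∈ T then none else p i) = freeCoords p ∪ T := by
    intro T _
    ext i
    by_cases hi : i ∈ T <;> simp [freeCoords, hi]
  refine Finset.card_bij' (fun q _ => freeCoords q \ freeCoords p)
    (fun T _ i => if i ∈ T then none else p i) ?_ ?_ ?_ ?_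
  · intro q hq
    obtain ⟨h1, h2⟩ := (Finset.mem_filter.1 hq).2
    rw [Finset.mem_powersetCard]
    refine ⟨fun i hi => Finset.mem_compl.2 (Finset.mem_sdiff.1 hi).2, ?_⟩
    rw [Finset.card_sdiff_of_subset (hsub q h1), h2]
    omega
  · intro T hT
    obtain ⟨h1, h2⟩ := Finset.mem_powersetCard.1 hT
    refine Finset.mem_filter.2 ⟨Finset.mem_univ _, patternFace_le_iff.2 ?_, ?_⟩
    · intro i b hb
      by_cases hi : i ∈ T
      · simp [hi] at hb
      · simpa [hi] using hb
    · rw [hfree T h1, Finset.card_union_of_disjoint, h2]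
      exact (Finset.disjoint_left.2 fun i hi hp => Finset.mem_compl.1 (h1 hi) hp).symm
  · intro q hq
    obtain ⟨h1, -⟩ := (Finset.mem_filter.1 hq).2
    funext i
    by_cases hi : i ∈ freeCoords q \ freeCoords p
    · simp only [hi, if_true]
      have := (Finset.mem_sdiff.1 hi).1
      simpa [freeCoords, eq_comm] using this
    · simp only [hi, if_false]
      cases hqi : q i with
      | some b => exact patternFace_le_iff.1 h1 i b hqi
      | none =>
        simpa [freeCoords, hqi] using hi
  · intro T hT
    obtain ⟨h1, -⟩ := Finset.mem_powersetCard.1 hT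
    rw [hfree T h1, Finset.union_sdiff_left]
    exact Finset.sdiff_eq_self_of_disjoint
      (Finset.disjoint_left.2 fun i hi hp => Finset.mem_compl.1 (h1 hi) hp)

theorem exists_fixed_coord {n : ℕ} {p : Fin n → Option Bool}
    (hp : (freeCoords p).card + 1 = n) :
    ∃ r b, p r = some b ∧ ∀ j, j ≠ r → p j = none := by
  classical
  have hc : (freeCoords p)ᶜ.card = 1 := by
    rw [Finset.card_compl, Fintype.card_fin]; omega
  obtain ⟨r, hr⟩ := Finset.card_eq_one.1 hc
  have hmem : ∀ j, p j ≠ none ↔ j = r := by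
    intro j
    rw [← Finset.mem_singleton, ← hr]
    simp [freeCoords]
  obtain ⟨b, hb⟩ := Option.ne_none_iff_exists'.1 ((hmem r).2 rfl)
  exact ⟨r, b, hb, fun j hj => by_contra fun h => hj ((hmem j).1 h)⟩

/-! ### Faces of a cube complex -/

section CubeComplex

variable {X : Type uX} [PartialOrder X]

theorem fdim_lt_fdim [GradeOrder ℤ X] {a b : X} (h : a < b) : fdim a < fdim b :=
  grade_strictMono (𝕆 := ℤ) h

theorem fdim_le_fdim [GradeOrder ℤ X] {a b : X} (h : a ≤ b) : fdim a ≤ fdim b :=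
  (grade_strictMono (𝕆 := ℤ)).monotone h

theorem fdim_add_one_of_covBy [GradeOrder ℤ X] {a b : X} (h : a ⋖ b) : fdim a + 1 = fdim b := by
  have h2 : fdim a ⋖ fdim b := GradeOrder.covBy_grade h
  rwa [Order.covBy_iff_add_one_eq] at h2

variable [OrderBot X] [GradeOrder ℤ X]

/-- The faces of a cell are the faces of a cube. -/
theorem IsCubeComplex.exists_equiv (hX : IsCubeComplex X) {x : X} {n : ℕ} (hx : fdim x = n) :
    ∃ e : Option (Fin n → Option Bool) ≃ Set.Iic x,
      (∀ c, fdim (e c).1 = patternDim c) ∧ (e none).1 = ⊥ ∧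
      ∀ p q, (e (some p)).1 ≤ (e (some q)).1 ↔ patternFace p ≤ patternFace q := by
  obtain ⟨hbot, hcube⟩ := hX
  have hne : x ≠ ⊥ := by rintro rfl; omega
  obtain ⟨m, hm, ⟨φ⟩⟩ := hcube x hne
  obtain rfl : n = m := by omega
  have hcov : ∀ {c c' : CubeFace n}, c ⋖ c' → fdim (φ.symm c).1 + 1 = fdim (φ.symm c').1 := by
    intro c c' h
    have h' : φ.symm c ⋖ φ.symm c' := (apply_covBy_apply_iff φ.symm).2 h
    exact fdim_add_one_of_covBy
      ⟨h'.1, fun b h1 h2 => h'.2 (c := ⟨b, h2.le.trans (φ.symm c').2⟩) h1 h2⟩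
  have hempty : (φ.symm (emptyFace n)).1 = ⊥ := by
    have : φ.symm (emptyFace n) ≤ ⟨⊥, Set.mem_Iic.2 bot_le⟩ := by
      rw [← φ.le_iff_le, φ.apply_symm_apply]
      exact emptyFace_le _
    exact le_bot_iff.1 this
  refine ⟨(cubeFaceEquiv n).trans φ.symm.toEquiv, ?_, hempty, fun p q => ?_⟩
  -- Fixing one free coordinate goes down one covering step, so induction on the number of free
  -- coordinates computes the dimension.
  · have hpat : ∀ (s : ℕ) (p : Fin n → Option Bool), (freeCoords p).card = s →
        fdim (φ.symm (patternFace p)).1 = s := by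
      intro s
      induction s with
      | zero =>
        intro p hp
        rw [← hcov (emptyFace_covBy (Finset.card_eq_zero.1 hp)), hempty, hbot]
        rfl
      | succ s ih =>
        intro p hp
        obtain ⟨i, hi⟩ := Finset.card_pos.1 (show 0 < (freeCoords p).card by omega)
        have hi' : p i = none := by simpa [freeCoords] using hi
        rw [← hcov (patternFace_covBy_update hi' true), ih]
        · push_cast; rfl
        · have : freeCoords (Function.update p i (some true)) = (freeCoords p).erase i := by
            ext j
            by_cases hj : j = i
            · subst hj; simp [freeCoords]
            · simp [freeCoords, hj]
          rw [this, Finset.card_erase_of_mem hi, hp]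
          rfl
    rintro (_ | p)
    · exact (congrArg fdim hempty).trans hbot
    · exact hpat _ p rfl
  · exact φ.symm.le_iff_le (x := patternFace p) (y := patternFace q)

theorem IsCubeComplex.fdim_nonneg (hX : IsCubeComplex X) {x : X} (hx : x ≠ ⊥) : 0 ≤ fdim x := by
  obtain ⟨n, hn, -⟩ := hX.2 x hx
  omega

theorem IsCubeComplex.neg_one_le_fdim (hX : IsCubeComplex X) (x : X) : -1 ≤ fdim x := by
  rw [← hX.1]
  exact fdim_le_fdim bot_le

theorem IsCubeComplex.eq_bot (hX : IsCubeComplex X) {x : X} (hx : fdim x = -1) : x = ⊥ := by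
  by_contra h
  have := hX.fdim_nonneg h
  omega

theorem IsCubeComplex.card_faces (hX : IsCubeComplex X) {y : X} {n : ℕ} (hy : fdim y = n)
    (i : ℤ) : Nat.card {x : X // fdim x = i ∧ x ≤ y} = cubeCount n i := by
  obtain ⟨e, hdim, -, -⟩ := hX.exists_equiv hy
  refine Nat.card_congr ?_
  refine Equiv.symm ((e.subtypeEquiv (q := fun x => fdim x.1 = i) fun c => by rw [hdim]).trans ?_)
  exact
    { toFun := fun x => ⟨x.1.1, x.2, x.1.2⟩
      invFun := fun x => ⟨⟨x.1, x.2.2⟩, x.2.1⟩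
      left_inv := fun _ => rfl
      right_inv := fun _ => rfl }

theorem IsCubeComplex.card_faces_le (hX : IsCubeComplex X) {y : X} {n : ℕ} (hy : fdim y = n) :
    Nat.card {x : X // x ≤ y} = 3 ^ n + 1 := by
  obtain ⟨e, -⟩ := hX.exists_equiv hy
  rw [← Nat.card_congr (α := Option (Fin n → Option Bool)) (β := {x : X // x ≤ y}) e]
  simp [Nat.card_eq_fintype_card]

/-- The count depends on dimensions only. This makes the denominators in the induced weight of a
link constant. The empty face has no pattern and is treated apart. -/
theorem IsCubeComplex.card_between (hX : IsCubeComplex X) {x z : X} {n : ℕ} (hxz : x ≤ z)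
    (hz : fdim z = n) {j : ℤ} (hj : fdim x ≤ j) :
    Nat.card {y : X // fdim y = j ∧ x ≤ y ∧ y ≤ z} = cubeUpCount n (fdim x) j := by
  by_cases hx : x = ⊥
  · subst hx
    rw [cubeUpCount, if_pos hX.1, ← hX.card_faces hz]
    simp
  have hx0 := hX.fdim_nonneg hx
  rw [cubeUpCount, if_neg (by omega)]
  obtain ⟨e, hdim, hnone, hle⟩ := hX.exists_equiv hz
  obtain ⟨c, hc⟩ := e.surjective ⟨x, hxz⟩
  rcases c with _ | p
  · exact absurd (hnone.symm.trans (congrArg Subtype.val hc)).symm hx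
  have hp : (e (some p)).1 = x := congrArg Subtype.val hc
  have hpd : fdim x = (freeCoords p).card := by rw [← hp, hdim]; rfl
  obtain ⟨s, rfl⟩ : ∃ s : ℕ, j = fdim x + s := ⟨(j - fdim x).toNat, by omega⟩
  have e1 : (fdim x).toNat = (freeCoords p).card := by omega
  have e2 : (fdim x + s).toNat - (freeCoords p).card = s := by omega
  rw [e1, e2, ← card_patterns_above p s]
  symm
  refine Nat.card_congr (Equiv.ofBijective
    (fun q => ⟨(e (some q.1)).1, ?_, ?_, (e (some q.1)).2⟩) ⟨?_, ?_⟩)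
  · rw [hdim, hpd]
    have := q.2.2
    simp only [patternDim, Option.elim]
    omega
  · rw [← hp]
    exact (hle _ _).2 q.2.1
  · intro q q' h
    have h0 : (e (some q.1)).1 = (e (some q'.1)).1 := congrArg (fun y => y.1) h
    have h1 : e (some q.1) = e (some q'.1) := Subtype.ext h0
    exact Subtype.ext (Option.some.inj (e.injective h1))
  · rintro ⟨y, h1, h2, h3⟩
    obtain ⟨c, hc⟩ := e.surjective ⟨y, h3⟩
    have hy : (e c).1 = y := congrArg Subtype.val hc
    rcases c with _ | q
    · rw [hnone] at hy
      subst hy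
      exact absurd (le_bot_iff.1 h2) hx
    · refine ⟨⟨q, ?_, ?_⟩, Subtype.ext hy⟩
      · rw [← hle, hp, hy]
        exact h2
      · have := hdim (some q)
        rw [hy, h1, hpd] at this
        simp only [patternDim, Option.elim] at this
        omega

/-- Two distinct facets of a cube meet in codimension two or are opposite. -/
theorem IsCubeComplex.facets_meet (hX : IsCubeComplex X) {a b c : X} {i : ℕ}
    (ha : fdim a = i) (hb : fdim b = i) (hc : fdim c = i + 1) (hac : a ≤ c) (hbc : b ≤ c)
    (hab : a ≠ b) :
    (∃ z, z ≤ a ∧ z ≤ b ∧ fdim z = (i : ℤ) - 1) ∨ (1 ≤ i ∧ infima {a, b} = {⊥}) := by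
  classical
  have hc' : fdim c = (i + 1 : ℕ) := by rw [hc]; push_cast; rfl
  obtain ⟨e, hdim, hnone, hle⟩ := hX.exists_equiv hc'
  have hsome : ∀ {x : X}, x ≤ c → x ≠ ⊥ → ∃ p, (e (some p)).1 = x := by
    intro x hx hne
    obtain ⟨p | p, hp⟩ := e.surjective ⟨x, hx⟩
    · exact absurd (hnone.symm.trans (congrArg Subtype.val hp)).symm hne
    · exact ⟨p, congrArg Subtype.val hp⟩
  have hne : ∀ {x : X}, fdim x = i → x ≠ ⊥ := by
    rintro x hx rfl
    have := hX.1
    omega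
  obtain ⟨p, rfl⟩ := hsome hac (hne ha)
  obtain ⟨q, rfl⟩ := hsome hbc (hne hb)
  have hp : (freeCoords p).card = i := by
    have := (hdim (some p)).symm.trans ha
    simpa [patternDim] using this
  have hq : (freeCoords q).card = i := by
    have := (hdim (some q)).symm.trans hb
    simpa [patternDim] using this
  obtain ⟨r, β, hpr, hp'⟩ := exists_fixed_coord (p := p) (by omega)
  obtain ⟨s, γ, hqs, hq'⟩ := exists_fixed_coord (p := q) (by omega)
  -- Each facet fixes a single coordinate. With the same coordinate the fixed values differ and the
  -- facets are disjoint; with different coordinates, fixing both gives the common facet.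
  by_cases hrs : r = s
  · subst hrs
    have hβγ : β ≠ γ := by
      rintro rfl
      refine hab (congrArg (fun p => (e (some p)).1) (funext fun j => ?_))
      by_cases hj : j = r
      · rw [hj, hpr, hqs]
      · rw [hp' j hj, hq' j hj]
    by_cases hi : 1 ≤ i
    · refine Or.inr ⟨hi, ?_⟩
      have hlow : ∀ x ∈ lowerBounds {(e (some p)).1, (e (some q)).1}, x = ⊥ := by
        intro x hx
        by_contra hxb
        have h1 : x ≤ (e (some p)).1 := hx (Set.mem_insert _ _)
        have h2 : x ≤ (e (some q)).1 := hx (Set.mem_insert_of_mem _ rfl)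
        obtain ⟨v, rfl⟩ := hsome (h1.trans hac) hxb
        have g1 := patternFace_le_iff.1 ((hle _ _).1 h1) r β hpr
        have g2 := patternFace_le_iff.1 ((hle _ _).1 h2) r γ hqs
        exact hβγ (Option.some.inj (g1.symm.trans g2))
      ext x
      constructor
      · exact fun hx => hlow x hx.1
      · rintro rfl
        exact ⟨fun y _ => bot_le, fun y hy _ => (hlow y hy).le⟩
    -- The two vertices of an edge belong to the first alternative: their common facet is ∅, of
    -- dimension -1.
    · exact Or.inl ⟨⊥, bot_le, bot_le, by rw [hX.1]; omega⟩
  · left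
    let v : Fin (i + 1) → Option Bool := Function.update p s (some γ)
    have hps : p s = none := hp' s (fun h => hrs h.symm)
    refine ⟨(e (some v)).1, (hle _ _).2 (patternFace_covBy_update hps γ).le,
      (hle _ _).2 (patternFace_le_iff.2 ?_), ?_⟩
    · intro j b hj
      by_cases hjs : j = s
      · subst hjs
        rw [← hj, hqs]
        simp [v]
      · simp [hq' j hjs] at hj
    · rw [hdim]
      have hv : freeCoords v = (freeCoords p).erase s := by
        ext j
        by_cases hj : j = s
        · subst hj; simp [v, freeCoords]
        · simp [v, freeCoords, hj]
      have hs : s ∈ freeCoords p := by simpa [freeCoords] using hps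
      have hpos := Finset.card_pos.2 ⟨s, hs⟩
      simp only [patternDim, Option.elim]
      rw [hv, Finset.card_erase_of_mem hs, hp]
      omega

end CubeComplex

/-! ### Weights -/

section WeightOf

variable {V W : Type*} [Fintype V] [Fintype W] {w w' : V → ℝ} {A B : Set V}

open Classical in
theorem weightOf_eq_sum (w : V → ℝ) (A : Set V) :
    weightOf w A = ∑ x ∈ Finset.univ.filter (· ∈ A), w x := by
  rw [weightOf, Finset.sum_filter]

theorem weightOf_nonneg (hw : ∀ x, 0 ≤ w x) (A : Set V) : 0 ≤ weightOf w A := by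
  classical
  rw [weightOf_eq_sum]
  exact Finset.sum_nonneg fun x _ => hw x

theorem weightOf_le_weightOf (h0 : ∀ x ∈ B, x ∉ A → 0 ≤ w' x) (hAB : A ⊆ B)
    (h : ∀ x ∈ A, w x ≤ w' x) : weightOf w A ≤ weightOf w' B := by
  classical
  refine Finset.sum_le_sum fun x _ => ?_
  by_cases hA : x ∈ A
  · rw [if_pos hA, if_pos (hAB hA)]; exact h x hA
  · rw [if_neg hA]
    split_ifs with hB
    · exact h0 x hB hA
    · exact le_rfl

theorem weightOf_mono (hw : ∀ x, 0 ≤ w x) (hAB : A ⊆ B) : weightOf w A ≤ weightOf w B :=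
  weightOf_le_weightOf (fun x _ _ => hw x) hAB fun _ _ => le_rfl

theorem weightOf_congr (h : ∀ x ∈ A, w x = w' x) : weightOf w A = weightOf w' A := by
  classical
  refine Finset.sum_congr rfl fun x _ => ?_
  split_ifs with hA
  · exact h x hA
  · rfl

theorem weightOf_const_mul (c : ℝ) (w : V → ℝ) (A : Set V) :
    weightOf (fun x => c * w x) A = c * weightOf w A := by
  classical
  rw [weightOf, weightOf, Finset.mul_sum]
  exact Finset.sum_congr rfl fun x _ => by split_ifs <;> simp

theorem weightOf_add (w w' : V → ℝ) (A : Set V) :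
    weightOf (fun x => w x + w' x) A = weightOf w A + weightOf w' A := by
  classical
  simp only [weightOf_eq_sum, Finset.sum_add_distrib]

theorem weightOf_one (A : Set V) : weightOf (fun _ => 1) A = Nat.card A := by
  classical
  rw [weightOf_eq_sum, Nat.card_eq_fintype_card, Fintype.card_subtype]
  simp

theorem weightOf_empty (w : V → ℝ) : weightOf w ∅ = 0 := by
  simp [weightOf]

theorem weightOf_union_le (hw : ∀ x, 0 ≤ w x) (A B : Set V) :
    weightOf w (A ∪ B) ≤ weightOf w A + weightOf w B := by
  classical
  rw [weightOf, weightOf, weightOf, ← Finset.sum_add_distrib]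
  refine Finset.sum_le_sum fun x _ => ?_
  by_cases hA : x ∈ A <;> by_cases hB : x ∈ B <;> simp [hA, hB, hw x]

theorem weightOf_union (h : Disjoint A B) :
    weightOf w (A ∪ B) = weightOf w A + weightOf w B := by
  classical
  rw [weightOf, weightOf, weightOf, ← Finset.sum_add_distrib]
  refine Finset.sum_congr rfl fun x _ => ?_
  by_cases hA : x ∈ A
  · simp [hA, Set.disjoint_left.1 h hA]
  · by_cases hB : x ∈ B <;> simp [hA, hB]

theorem weightOf_iUnion_le (hw : ∀ x, 0 ≤ w x) {ι : Type*} (S : Finset ι) (A : ι → Set V) :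
    weightOf w (⋃ i ∈ S, A i) ≤ ∑ i ∈ S, weightOf w (A i) := by
  classical
  induction S using Finset.induction_on with
  | empty => simp [weightOf_empty]
  | insert i S hi ih =>
    rw [Finset.set_biUnion_insert, Finset.sum_insert hi]
    exact (weightOf_union_le hw _ _).trans (by gcongr)

theorem weightOf_image {e : W → V} (he : Function.Injective e) (w : V → ℝ) (A : Set W) :
    weightOf w (e '' A) = weightOf (fun x => w (e x)) A := by
  classical
  rw [weightOf_eq_sum, weightOf_eq_sum]
  symm
  refine Finset.sum_bij (fun x _ => e x) ?_ (fun _ _ _ _ h => he h) ?_ (fun _ _ => rfl)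
  · intro x hx
    simp only [Finset.mem_filter, Finset.mem_univ, true_and] at hx ⊢
    exact ⟨x, hx, rfl⟩
  · intro y hy
    simp only [Finset.mem_filter, Finset.mem_univ, true_and] at hy
    obtain ⟨x, hx, rfl⟩ := hy
    exact ⟨x, by simpa using hx, rfl⟩

/-- Double counting. -/
theorem weightOf_weightOf (w : V → ℝ) (P : Set W) (r : W → V → Prop) :
    weightOf (fun x => weightOf w {y | r x y}) P =
      weightOf (fun y => (Nat.card {x : W // x ∈ P ∧ r x y} : ℝ) * w y) Set.univ := by
  classical
  simp only [weightOf, Set.mem_univ, if_true, Set.mem_ofPred_eq]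
  have h1 : ∀ x, (if x ∈ P then ∑ y, (if r x y then w y else 0) else 0) =
      ∑ y, if x ∈ P ∧ r x y then w y else 0 := by
    intro x
    by_cases hx : x ∈ P <;> simp [hx]
  simp_rw [h1]
  rw [Finset.sum_comm]
  refine Finset.sum_congr rfl fun y _ => ?_
  rw [← Finset.sum_filter, Finset.sum_const, nsmul_eq_mul, Nat.card_eq_fintype_card,
    Fintype.card_subtype]

/-- Weights of pairs are bounded by the number of partners. -/
theorem weightOf_weightOf_le {w : V → ℝ} (hw : ∀ x, 0 ≤ w x) (P : Set W) (r : W → V → Prop)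
    (Q : Set V) (hQ : ∀ x ∈ P, ∀ y, r x y → y ∈ Q) (c : ℝ)
    (hc : ∀ y ∈ Q, (Nat.card {x : W // x ∈ P ∧ r x y} : ℝ) ≤ c) :
    weightOf (fun x => weightOf w {y | r x y}) P ≤ c * weightOf w Q := by
  rw [weightOf_weightOf, ← weightOf_const_mul]
  have h : weightOf (fun y => (Nat.card {x : W // x ∈ P ∧ r x y} : ℝ) * w y) Set.univ =
      weightOf (fun y => (Nat.card {x : W // x ∈ P ∧ r x y} : ℝ) * w y) Q := by
    classical
    rw [weightOf, weightOf]
    refine Finset.sum_congr rfl fun y _ => ?_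
    by_cases hy : y ∈ Q
    · simp [hy]
    · have : IsEmpty {x : W // x ∈ P ∧ r x y} := ⟨fun x => hy (hQ x.1 x.2.1 y x.2.2)⟩
      simp [hy]
  rw [h]
  exact weightOf_le_weightOf (fun _ h1 h2 => absurd h1 h2) le_rfl
    fun y hy => mul_le_mul_of_nonneg_right (hc y hy) (hw y)

/-- A set covered by neighbourhoods weighs at most as much as the neighbourhoods together. -/
theorem weightOf_le_weightOf_weightOf {w : V → ℝ} (hw : ∀ x, 0 ≤ w x) (P : Set W)
    (r : W → V → Prop) (Q : Set V) (hQ : ∀ y ∈ Q, ∃ x ∈ P, r x y) :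
    weightOf w Q ≤ weightOf (fun x => weightOf w {y | r x y}) P := by
  rw [weightOf_weightOf]
  refine weightOf_le_weightOf (fun y _ _ => mul_nonneg (Nat.cast_nonneg _) (hw y))
    (Set.subset_univ _) fun y hy => ?_
  obtain ⟨x, hx, hr⟩ := hQ y hy
  have : Nonempty {x : W // x ∈ P ∧ r x y} := ⟨⟨x, hx, hr⟩⟩
  exact le_mul_of_one_le_left (hw y) (by exact_mod_cast Nat.card_pos)

end WeightOf

/-! ### Face counts of cubes and identities for proper weights. -/

theorem cubeCount_pos {n : ℕ} {i : ℤ} (h1 : -1 ≤ i) (h2 : i ≤ n) : 0 < cubeCount n i := by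
  have : Nonempty {c : Option (Fin n → Option Bool) // patternDim c = i} := by
    obtain rfl | h := eq_or_lt_of_le h1
    · exact ⟨⟨none, rfl⟩⟩
    · refine ⟨⟨some fun k => if (k : ℕ) < i.toNat then none else some true, ?_⟩⟩
      have : freeCoords (fun k : Fin n => if (k : ℕ) < i.toNat then none else some true) =
          Finset.univ.filter fun k : Fin n => (k : ℕ) < i.toNat := by
        ext k
        simp [freeCoords]
      simp only [patternDim, Option.elim]
      rw [this, Fin.card_filter_val_lt]
      omega
  exact Nat.card_pos

theorem cubeCount_cast_pos {X : Type uX} [PartialOrder X] [OrderBot X] [GradeOrder ℤ X]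
    (hX : IsCubeComplex X) {x : X} {n : ℕ} (h : fdim x ≤ n) : (0 : ℝ) < cubeCount n (fdim x) :=
  Nat.cast_pos.2 (cubeCount_pos (hX.neg_one_le_fdim x) h)

theorem cubeCount_neg_one (n : ℕ) : cubeCount n (-1) = 1 := by
  have : Unique {c : Option (Fin n → Option Bool) // patternDim c = -1} :=
    { default := ⟨none, rfl⟩
      uniq := by
        rintro ⟨_ | p, h⟩
        · rfl
        · simp only [patternDim, Option.elim] at h
          omega }
  exact Nat.card_unique

section ProperWeight

variable {X : Type uX} [PartialOrder X] [Fintype X] [GradeOrder ℤ X]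
  {d : ℕ} {w : X → ℝ}

theorem IsProperWeight.nonneg (hw : IsProperWeight d w) (x : X) : 0 ≤ w x := (hw.pos x).le

theorem IsProperWeight.fdim_le (hw : IsProperWeight d w) (x : X) : fdim x ≤ d := by
  obtain ⟨y, hy, hxy⟩ := hw.pure.2 x
  exact hy ▸ fdim_le_fdim hxy

theorem linkWeight_nonneg (hw : IsProperWeight d w) {u : X} (x : Link u) :
    0 ≤ linkWeight d w u x :=
  mul_nonneg (inv_nonneg.2 (weightOf_nonneg hw.nonneg _))
    (weightOf_nonneg (fun y => div_nonneg (hw.nonneg y) (Nat.cast_nonneg _)) _)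

variable [OrderBot X]

/-- All d-faces are d-cubes, so the denominator in the definition of a proper weight is constant. -/
theorem IsProperWeight.weightOf_top (hw : IsProperWeight d w) (hX : IsCubeComplex X) (x : X) :
    weightOf w {y | fdim y = d ∧ x ≤ y} = cubeCount d (fdim x) * w x := by
  have hpos : (0 : ℝ) < cubeCount d (fdim x) :=
    Nat.cast_pos.2 (cubeCount_pos (hX.neg_one_le_fdim x) (hw.fdim_le x))
  have h1 : w x = weightOf (fun y => (cubeCount d (fdim x) : ℝ)⁻¹ * w y)
      {y | fdim y = d ∧ x ≤ y} := by
    refine (hw.proper x).trans (weightOf_congr fun y hy => ?_)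
    rw [← hX.card_faces hy.1 (fdim x), div_eq_inv_mul]
    rfl
  rw [weightOf_const_mul] at h1
  rw [h1, mul_inv_cancel_left₀ hpos.ne']

theorem IsProperWeight.bot (hw : IsProperWeight d w) (hX : IsCubeComplex X) : w ⊥ = 1 := by
  have h1 := hw.weightOf_top hX ⊥
  simp only [bot_le, and_true, hw.total, hX.1, cubeCount_neg_one, Nat.cast_one, one_mul] at h1
  exact h1.symm

/-- Both sides count the pairs a ≤ b of faces of one d-cube with dim a = dim x and dim b = j. -/
theorem cubeUpCount_mul_cubeCount (hw : IsProperWeight d w) (hX : IsCubeComplex X) (x : X) {j : ℕ}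
    (hxj : fdim x ≤ j) :
    cubeUpCount d (fdim x) j * cubeCount d (fdim x) = cubeCount d j * cubeCount j (fdim x) := by
  obtain ⟨z, hz, hxz⟩ := hw.pure.2 x
  have h := weightOf_weightOf (fun _ : X => (1 : ℝ)) {a : X | fdim a = fdim x ∧ a ≤ z}
    (fun a b => fdim b = j ∧ a ≤ b ∧ b ≤ z)
  have h1 : weightOf (fun a => weightOf (fun _ : X => (1 : ℝ)) {b | fdim b = j ∧ a ≤ b ∧ b ≤ z})
      {a : X | fdim a = fdim x ∧ a ≤ z} = cubeUpCount d (fdim x) j * cubeCount d (fdim x) := by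
    rw [weightOf_congr (w' := fun _ => (cubeUpCount d (fdim x) j : ℝ) * 1), weightOf_const_mul,
      weightOf_one, ← hX.card_faces hz (fdim x)]
    · rfl
    · intro a ha
      rw [weightOf_one, mul_one, ← ha.1, ← hX.card_between ha.2 hz (ha.1.le.trans hxj)]
      rfl
  have h2 : weightOf (fun y => (Nat.card {a : X // a ∈ {a : X | fdim a = fdim x ∧ a ≤ z} ∧
      (fdim y = j ∧ a ≤ y ∧ y ≤ z)} : ℝ) * 1) Set.univ = cubeCount d j * cubeCount j (fdim x) := by
    have h3 : (cubeCount d j : ℝ) = weightOf (fun _ => (1 : ℝ)) {y : X | fdim y = j ∧ y ≤ z} := by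
      rw [weightOf_one, ← hX.card_faces hz j]
      rfl
    rw [h3, mul_comm, ← weightOf_const_mul]
    classical
    rw [weightOf, weightOf]
    refine Finset.sum_congr rfl fun y _ => ?_
    by_cases hy : fdim y = j ∧ y ≤ z
    · rw [if_pos (Set.mem_univ y), if_pos (show y ∈ {y : X | fdim y = j ∧ y ≤ z} from hy),
        ← hX.card_faces hy.1 (fdim x)]
      congr 2
      refine Nat.card_congr (Equiv.subtypeEquivRight fun a => ?_)
      simp only [Set.mem_ofPred_eq]
      exact ⟨fun h => ⟨h.1.1, h.2.2.1⟩, fun h => ⟨⟨h.1, h.2.trans hy.2⟩, hy.1, h.2, hy.2⟩⟩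
    · have : IsEmpty {a : X // a ∈ {a : X | fdim a = fdim x ∧ a ≤ z} ∧
        (fdim y = j ∧ a ≤ y ∧ y ≤ z)} := ⟨fun a => hy ⟨a.2.2.1, a.2.2.2.2⟩⟩
      rw [if_neg (show y ∉ {y : X | fdim y = j ∧ y ≤ z} from hy), Nat.card_of_isEmpty]
      simp
  have := h1.symm.trans (h.trans h2)
  exact_mod_cast this

theorem cubeUpCount_cast_pos (hw : IsProperWeight d w) (hX : IsCubeComplex X) (x : X) {j : ℕ}
    (hxj : fdim x ≤ j) (hj : j ≤ d) : (0 : ℝ) < cubeUpCount d (fdim x) j := by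
  have h := cubeUpCount_mul_cubeCount hw hX x hxj
  have h2 : 0 < cubeUpCount d (fdim x) j * cubeCount d (fdim x) := by
    rw [h]
    exact Nat.mul_pos (cubeCount_pos (by omega) (by omega))
      (cubeCount_pos (hX.neg_one_le_fdim x) hxj)
  exact Nat.cast_pos.2 (Nat.pos_of_mul_pos_right h2)

/-- Multiplied by `cubeCount d j`, both sides become sums over d-faces above x; each such face
contains `cubeUpCount d (fdim x) j` of the faces y. In probabilistic terms, a random face of a
random j-face is a random face. -/
theorem IsProperWeight.weightOf_up (hw : IsProperWeight d w) (hX : IsCubeComplex X) (x : X)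
    {j : ℕ} (hxj : fdim x ≤ j) (hj : j ≤ d) :
    weightOf w {y | fdim y = j ∧ x ≤ y} = cubeCount j (fdim x) * w x := by
  have hpos : (0 : ℝ) < cubeCount d j := Nat.cast_pos.2 (cubeCount_pos (by omega) (by omega))
  refine mul_left_cancel₀ hpos.ne' ?_
  have h1 : (cubeCount d j : ℝ) * weightOf w {y | fdim y = j ∧ x ≤ y} =
      weightOf (fun y => weightOf w {z | fdim z = d ∧ y ≤ z}) {y | fdim y = j ∧ x ≤ y} := by
    rw [← weightOf_const_mul]
    refine weightOf_congr fun y hy => ?_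
    rw [hw.weightOf_top hX, hy.1]
  have h2 : weightOf (fun z => (Nat.card {y : X // y ∈ {y : X | fdim y = j ∧ x ≤ y} ∧
      (fdim z = d ∧ y ≤ z)} : ℝ) * w z) Set.univ =
      cubeUpCount d (fdim x) j * weightOf w {z | fdim z = d ∧ x ≤ z} := by
    rw [← weightOf_const_mul]
    classical
    rw [weightOf, weightOf]
    refine Finset.sum_congr rfl fun z _ => ?_
    by_cases hz : fdim z = d ∧ x ≤ z
    · rw [if_pos (Set.mem_univ z), if_pos (show z ∈ {z : X | fdim z = d ∧ x ≤ z} from hz),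
        ← hX.card_between hz.2 hz.1 hxj]
      congr 2
      refine Nat.card_congr (Equiv.subtypeEquivRight fun a => ?_)
      simp only [Set.mem_ofPred_eq]
      exact ⟨fun h => ⟨h.1.1, h.1.2, h.2.2⟩, fun h => ⟨⟨h.1, h.2.1⟩, hz.1, h.2.2⟩⟩
    · have : IsEmpty {y : X // y ∈ {y : X | fdim y = j ∧ x ≤ y} ∧ (fdim z = d ∧ y ≤ z)} :=
        ⟨fun a => hz ⟨a.2.2.1, a.2.1.2.trans a.2.2.2⟩⟩
      rw [if_neg (show z ∉ {z : X | fdim z = d ∧ x ≤ z} from hz), Nat.card_of_isEmpty]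
      simp
  rw [h1, weightOf_weightOf, h2, hw.weightOf_top hX, ← mul_assoc, ← mul_assoc]
  congr 1
  exact_mod_cast cubeUpCount_mul_cubeCount hw hX x hxj

/-- In each fixed dimension the weight of a link is a rescaling of w, so that all estimates in links
can be carried out in X. -/
theorem linkWeight_eq (hw : IsProperWeight d w) (hX : IsCubeComplex X) {u : X} (x : Link u)
    {j : ℕ} (hj : fdim x.face = j) :
    linkWeight d w u x = (cubeCount j (fdim u) * w u)⁻¹ * w x.face := by
  have huj : fdim u ≤ j := hj ▸ fdim_le_fdim x.le_face
  have hjd : j ≤ d := by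
    have := hw.fdim_le x.face
    omega
  have hM := cubeUpCount_cast_pos hw hX u huj hjd
  have h1 : weightOf (fun y => w y /
      (Set.ncard {x' : X | fdim x' = fdim x.face ∧ u ≤ x' ∧ x' ≤ y} : ℝ))
      {y | fdim y = d ∧ x.face ≤ y} =
      (cubeUpCount d (fdim u) j : ℝ)⁻¹ * weightOf w {y | fdim y = d ∧ x.face ≤ y} := by
    rw [← weightOf_const_mul]
    refine weightOf_congr fun y hy => ?_
    rw [← hX.card_between (x.le_face.trans hy.2) hy.1 huj, div_eq_inv_mul, hj]
    rfl
  have hc : (cubeUpCount d (fdim u) j : ℝ) * cubeCount d (fdim u) =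
      cubeCount d j * cubeCount j (fdim u) := by
    exact_mod_cast cubeUpCount_mul_cubeCount hw hX u huj
  have p1 := cubeCount_cast_pos hX (hw.fdim_le u)
  have p2 := cubeCount_cast_pos hX huj
  have p3 := cubeCount_cast_pos hX (hw.fdim_le x.face)
  have p4 := hw.pos u
  rw [linkWeight, h1, hw.weightOf_top hX, hw.weightOf_top hX]
  rw [hj] at p3 ⊢
  field_simp
  linear_combination (-(w x.face)) * hc

/-- Weights of sets of faces of the link, computed in `X`. -/
theorem weightOf_link (hw : IsProperWeight d w) (hX : IsCubeComplex X) (u : X) {i : ℤ} {j : ℕ}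
    (hij : i = j - fdim u - 1) (A : Set (Face (Link u) i)) :
    cubeCount j (fdim u) * w u * weightOf (fun x => linkWeight d w u x.1) A =
      weightOf w ((fun x : Face (Link u) i => x.1.face) '' A) := by
  have hdim : ∀ x : Face (Link u) i, fdim x.1.face = j := by
    intro x
    have h1 := x.2
    rw [fdim_link] at h1
    omega
  rw [weightOf_image (fun x y h => Subtype.ext (Link.ext h)), ← weightOf_const_mul]
  refine weightOf_congr fun x _ => ?_
  have huj : fdim u ≤ j := hdim x ▸ fdim_le_fdim x.1.le_face
  have p2 := cubeCount_cast_pos hX huj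
  have p4 := hw.pos u
  rw [linkWeight_eq hw hX x.1 (hdim x), mul_inv_cancel_left₀ (by positivity)]

end ProperWeight

/-! ### Cochains -/

section Cochains

variable {R : Type uR} [CommRing R] {X : Type uX} [PartialOrder X] [GradeOrder ℤ X]
  {F : PosetSheaf.{uR, uX, uM} R X} {w : X → ℝ}

/-- The support of a cochain, as a set of faces. -/
def csupp {i : ℤ} (f : Cochain F i) : Set X := {x | ∃ h : fdim x = i, f ⟨x, h⟩ ≠ 0}

theorem mem_csupp {i : ℤ} {f : Cochain F i} (x : Face X i) : x.1 ∈ csupp f ↔ f x ≠ 0 :=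
  ⟨fun ⟨_, h⟩ => h, fun h => ⟨x.2, h⟩⟩

theorem image_support_eq_csupp {i : ℤ} (f : Cochain F i) :
    Subtype.val '' {x : Face X i | f x ≠ 0} = csupp f := by
  ext x
  constructor
  · rintro ⟨x, hx, rfl⟩
    exact ⟨x.2, hx⟩
  · rintro ⟨h, hx⟩
    exact ⟨⟨x, h⟩, hx, rfl⟩

/-- Restriction of a cochain to the link of `u`. -/
def restrictLink (u : X) {i j : ℤ} (hj : j = i - fdim u - 1) (f : Cochain F i) :
    Cochain (F.link u) j :=
  fun x => f ⟨x.1.face, by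
    have := x.2
    rw [fdim_link] at this
    omega⟩

open Classical in
/-- Extension by zero of a cochain on the link of `u`. -/
noncomputable def extendZero (u : X) {i j : ℤ} (hj : j = i - fdim u - 1)
    (g : Cochain (F.link u) j) : Cochain F i := fun x =>
  if h : u ≤ x.1 then g ⟨⟨x.1, h⟩, by rw [fdim_link, x.2, hj]⟩ else 0

/-- `extendZero` and `restrictLink` take the degree in the link up to a proof of equality, which
avoids transporting cochains between equal degrees. -/
theorem extendZero_eq_extendLink (u : X) {i : ℤ} (g : Cochain (F.link u) (i - fdim u - 1)) :
    extendZero u rfl g = extendLink u g := rfl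

theorem restrictLink_extendZero (u : X) {i j : ℤ} (hj : j = i - fdim u - 1)
    (g : Cochain (F.link u) j) : restrictLink u hj (extendZero u hj g) = g := by
  funext x
  exact dif_pos x.1.le_face

theorem extendZero_neg (u : X) {i j : ℤ} (hj : j = i - fdim u - 1) (g : Cochain (F.link u) j) :
    extendZero u hj (-g) = -extendZero u hj g := by
  funext x
  by_cases hx : u ≤ x.1
  · have h : ∀ g' : Cochain (F.link u) j,
        extendZero u hj g' x = g' ⟨⟨x.1, hx⟩, by rw [fdim_link, x.2, hj]⟩ := fun g' => dif_pos hx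
    rw [Pi.neg_apply, h, h]
    rfl
  · simp [extendZero, hx]

theorem le_of_extendZero_ne_zero {u : X} {i j : ℤ} {hj : j = i - fdim u - 1}
    {g : Cochain (F.link u) j} {x : Face X i} (h : extendZero u hj g x ≠ 0) : u ≤ x.1 := by
  by_contra hx
  exact h (dif_neg hx)

theorem image_csupp_restrictLink {u : X} {i j : ℤ} (hj : j = i - fdim u - 1) {f : Cochain F i}
    (hf : ∀ x, f x ≠ 0 → u ≤ x.1) :
    (fun x : Face (Link u) j => x.1.face) '' {x | restrictLink u hj f x ≠ 0} = csupp f := by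
  ext x
  constructor
  · rintro ⟨x, hx, rfl⟩
    exact ⟨_, hx⟩
  · rintro ⟨h, hx⟩
    exact ⟨⟨⟨x, hf _ hx⟩, by rw [fdim_link, h, hj]⟩, hx, rfl⟩

variable [Fintype X]

theorem cnorm_eq_weightOf_csupp (w : X → ℝ) {i : ℤ} (f : Cochain F i) :
    cnorm w f = weightOf w (csupp f) := by
  rw [← image_support_eq_csupp, weightOf_image Subtype.val_injective]
  rfl

theorem cnorm_nonneg (hw : ∀ x, 0 ≤ w x) {i : ℤ} (f : Cochain F i) : 0 ≤ cnorm w f :=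
  weightOf_nonneg (fun x : Face X i => hw x.1) _

theorem cnorm_zero (w : X → ℝ) (i : ℤ) : cnorm w (0 : Cochain F i) = 0 := by
  simp [cnorm, weightOf]

theorem cnorm_neg (w : X → ℝ) {i : ℤ} (f : Cochain F i) : cnorm w (-f) = cnorm w f := by
  simp [cnorm]

theorem cnorm_add_le (hw : ∀ x, 0 ≤ w x) {i : ℤ} (f g : Cochain F i) :
    cnorm w (f + g) ≤ cnorm w f + cnorm w g := by
  refine le_trans (weightOf_mono (fun x : Face X i => hw x.1) fun x hx => ?_)
    (weightOf_union_le (fun x : Face X i => hw x.1) _ _)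
  by_contra h
  have h1 : f x = 0 := by by_contra h1; exact h (Or.inl h1)
  have h2 : g x = 0 := by by_contra h2; exact h (Or.inr h2)
  exact hx (show f x + g x = 0 by rw [h1, h2, add_zero])

theorem eq_zero_of_cnorm_eq_zero (hw : ∀ x, 0 < w x) {i : ℤ} {f : Cochain F i}
    (h : cnorm w f = 0) : f = 0 := by
  classical
  funext x
  by_contra hx
  rw [cnorm, weightOf] at h
  have := (Finset.sum_eq_zero_iff_of_nonneg fun y _ => by
    split_ifs
    · exact (hw y.1).le
    · exact le_rfl).1 h x (Finset.mem_univ _)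
  rw [if_pos (show x ∈ {x | f x ≠ 0} from hx)] at this
  exact (hw x.1).ne' this

theorem cdist_le (hw : ∀ x, 0 ≤ w x) {i : ℤ} (f : Cochain F i) {S : Submodule R (Cochain F i)}
    {g : Cochain F i} (hg : g ∈ S) : cdist w f S ≤ cnorm w (f - g) :=
  ciInf_le (f := fun g : S => cnorm w (f - g.1))
    ⟨0, by rintro _ ⟨g, rfl⟩; exact cnorm_nonneg hw _⟩ ⟨g, hg⟩

theorem le_cdist {i : ℤ} {f : Cochain F i} {S : Submodule R (Cochain F i)} {c : ℝ}
    (h : ∀ g ∈ S, c ≤ cnorm w (f - g)) : c ≤ cdist w f S :=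
  le_ciInf fun g => h g.1 g.2

/-- The supremum defining `cbe` is attained: for f at positive distance, every admissible μ is at
most the ratio of ‖df‖ to that distance. -/
theorem mul_cdist_le_of_le_cbe (hw : ∀ x, 0 ≤ w x) {o : POrientation R X} {i : ℤ} {ε : ℝ}
    (h : ENNReal.ofReal ε ≤ cbe i w o F) (f : Cochain F i) :
    ε * cdist w f (coboundaries o F i) ≤ cnorm w (coboundary o F i (i + 1) f) := by
  by_contra! hlt
  have hn := cnorm_nonneg hw (coboundary o F i (i + 1) f)
  have hd0 : 0 ≤ cdist w f (coboundaries o F i) := le_cdist fun g _ => cnorm_nonneg hw _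
  have hd : 0 < cdist w f (coboundaries o F i) := by
    refine lt_of_le_of_ne hd0 fun h0 => ?_
    rw [← h0, mul_zero] at hlt
    linarith
  have h1 : cbe i w o F ≤
      ENNReal.ofReal (cnorm w (coboundary o F i (i + 1) f) / cdist w f (coboundaries o F i)) := by
    refine sSup_le ?_
    rintro _ ⟨μ, hμ, rfl⟩
    change (μ : ℝ≥0∞) ≤ _
    rw [← ENNReal.ofReal_coe_nnreal]
    exact ENNReal.ofReal_le_ofReal ((le_div_iff₀ hd).2 (hμ f))
  have h2 := (ENNReal.ofReal_le_ofReal_iff (div_nonneg hn hd.le)).1 (h.trans h1)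
  rw [le_div_iff₀ hd] at h2
  linarith

theorem ofReal_le_cse {o : POrientation R X} {i : ℤ} {μ : ℝ} (hμ : 0 ≤ μ)
    (h : ∀ f : Cochain F i,
      μ * cdist w f (cocycles o F i) ≤ cnorm w (coboundary o F i (i + 1) f)) :
    ENNReal.ofReal μ ≤ cse i w o F :=
  le_sSup ⟨μ.toNNReal, fun f => by rw [Real.coe_toNNReal μ hμ]; exact h f, rfl⟩

open Classical in
theorem coboundary_apply (o : POrientation R X) (i j : ℤ) (f : Cochain F i) (y : Face X j) :
    coboundary o F i j f y =
      ∑ x : Face X i, if h : x.1 ≤ y.1 then (o.sgn y.1 x.1 : R) • F.res h (f x) else 0 := by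
  simp only [coboundary, LinearMap.pi_apply, LinearMap.sum_apply]
  refine Finset.sum_congr rfl fun x _ => ?_
  split_ifs <;> rfl

theorem exists_le_of_coboundary_ne_zero {o : POrientation R X} {i j : ℤ} {f : Cochain F i}
    {y : Face X j} (h : coboundary o F i j f y ≠ 0) : ∃ x : Face X i, x.1 ≤ y.1 ∧ f x ≠ 0 := by
  classical
  by_contra! hcon
  refine h ?_
  rw [coboundary_apply]
  refine Finset.sum_eq_zero fun x _ => ?_
  split_ifs with hx
  · rw [hcon x hx, map_zero, smul_zero]
  · rfl

/-- The coboundary at a face depends only on the values on its facets. -/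
theorem coboundary_congr {o : POrientation R X} {i j : ℤ} {f g : Cochain F i} {y : Face X j}
    (h : ∀ x : Face X i, x.1 ≤ y.1 → f x = g x) :
    coboundary o F i j f y = coboundary o F i j g y := by
  classical
  rw [coboundary_apply, coboundary_apply]
  refine Finset.sum_congr rfl fun x _ => ?_
  split_ifs with hx
  · rw [h x hx]
  · rfl

theorem coboundary_coboundary (o : POrientation R X) {i j l : ℤ} (hij : j = i + 1)
    (hjl : l = j + 1) (f : Cochain F i) :
    coboundary o F j l (coboundary o F i j f) = 0 := by
  classical
  subst hij hjl
  funext z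
  rw [coboundary_apply, Pi.zero_apply]
  -- By functoriality the restriction through y does not depend on y. After exchanging the sums, the
  -- coefficient of each f(x) is the sum that the orientation axiom makes zero.
  have h1 : ∀ y : Face X (i + 1), (if h : y.1 ≤ z.1 then
      (o.sgn z.1 y.1 : R) • F.res h (coboundary o F i (i + 1) f y) else 0) =
      ∑ x : Face X i, if h : x.1 ≤ z.1 then (if x.1 < y.1 ∧ y.1 < z.1 then
        (o.sgn z.1 y.1 : R) * (o.sgn y.1 x.1 : R) else 0) • F.res h (f x) else 0 := by
    intro y
    by_cases hyz : y.1 ≤ z.1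
    · rw [dif_pos hyz, coboundary_apply, map_sum, Finset.smul_sum]
      refine Finset.sum_congr rfl fun x _ => ?_
      by_cases hxy : x.1 ≤ y.1
      · have l1 : x.1 < y.1 := lt_of_le_of_ne hxy fun h => by
          have := congrArg fdim h
          rw [x.2, y.2] at this
          omega
        have l2 : y.1 < z.1 := lt_of_le_of_ne hyz fun h => by
          have := congrArg fdim h
          rw [y.2, z.2] at this
          omega
        rw [dif_pos hxy, dif_pos (hxy.trans hyz), if_pos ⟨l1, l2⟩, map_smul, smul_smul,
          ← F.res_comp hxy hyz]
        rfl
      · rw [dif_neg hxy, map_zero, smul_zero, if_neg fun h => hxy h.1.le]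
        split_ifs <;> simp
    · rw [dif_neg hyz]
      refine (Finset.sum_eq_zero fun x _ => ?_).symm
      rw [if_neg fun h => hyz h.2.le]
      split_ifs <;> simp
  simp_rw [h1]
  rw [Finset.sum_comm]
  refine Finset.sum_eq_zero fun x _ => ?_
  by_cases hxz : x.1 ≤ z.1
  · simp only [dif_pos hxz]
    rw [← Finset.sum_smul]
    have h2 := o.sum_eq_zero x.1 z.1 hxz (by rw [x.2, z.2]; omega)
    have h3 : ∑ y : Face X (i + 1), (if x.1 < y.1 ∧ y.1 < z.1 then
        (o.sgn z.1 y.1 : R) * (o.sgn y.1 x.1 : R) else 0) = 0 := by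
      refine Eq.trans ?_ h2
      refine Fintype.sum_of_injective Subtype.val Subtype.val_injective _ _ ?_ fun y => rfl
      intro y hy
      refine if_neg fun h => hy ⟨⟨y, ?_⟩, rfl⟩
      have g1 := fdim_lt_fdim h.1
      have g2 := fdim_lt_fdim h.2
      rw [x.2] at g1
      rw [z.2] at g2
      omega
    rw [h3, zero_smul]
  · simp only [dif_neg hxz, Finset.sum_const_zero]

theorem coboundary_mem_cocycles (o : POrientation R X) {i j : ℤ} (hij : j = i + 1)
    (f : Cochain F i) : coboundary o F i j f ∈ cocycles o F j :=
  LinearMap.mem_ker.2 (coboundary_coboundary o hij rfl f)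

/-! ### Cochains on links -/

theorem le_of_coboundary_ne_zero {o : POrientation R X} {u : X} {i j : ℤ} {f : Cochain F i}
    (hf : ∀ x, f x ≠ 0 → u ≤ x.1) {y : Face X j} (h : coboundary o F i j f y ≠ 0) : u ≤ y.1 := by
  obtain ⟨x, hx, hfx⟩ := exists_le_of_coboundary_ne_zero h
  exact (hf x hfx).trans hx

/-- Faces outside the link contribute nothing, since f vanishes on them. -/
theorem coboundary_link {o : POrientation R X} {u : X} {i i' j j' : ℤ}
    (hj : j = i - fdim u - 1) (hj' : j' = i' - fdim u - 1) {f : Cochain F i}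
    (hf : ∀ x, f x ≠ 0 → u ≤ x.1) :
    coboundary (o.link u) (F.link u) j j' (restrictLink u hj f) =
      restrictLink u hj' (coboundary o F i i' f) := by
  classical
  funext y
  rw [coboundary_apply]
  refine Eq.trans ?_ (coboundary_apply o i i' f ⟨y.1.face, by
    have := y.2
    rw [fdim_link] at this
    omega⟩).symm
  refine Fintype.sum_of_injective
    (fun x : Face (Link u) j => (⟨x.1.face, by
      have := x.2
      rw [fdim_link] at this
      omega⟩ : Face X i)) ?_ _ _ ?_ ?_
  · intro x x' h
    exact Subtype.ext (Link.ext (congrArg Subtype.val h))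
  · intro x hx
    split_ifs with hxy
    · have : f x = 0 := by
        by_contra h0
        exact hx ⟨⟨⟨x.1, hf x h0⟩, by rw [fdim_link, x.2, hj]⟩, rfl⟩
      rw [this, map_zero, smul_zero]
      rfl
    · rfl
  · intro x
    exact dite_congr rfl (fun _ => rfl) fun _ => rfl

theorem cnorm_link [OrderBot X] {d : ℕ} (hw : IsProperWeight d w) (hX : IsCubeComplex X) {u : X}
    {n : ℕ} {i j : ℤ} (hi : i = n) (hj : j = i - fdim u - 1) {f : Cochain F i}
    (hf : ∀ x, f x ≠ 0 → u ≤ x.1) :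
    cubeCount n (fdim u) * w u * cnorm (linkWeight d w u) (restrictLink u hj f) = cnorm w f := by
  subst hi
  rw [cnorm, weightOf_link hw hX u hj, image_csupp_restrictLink hj hf, cnorm_eq_weightOf_csupp]

theorem cnorm_le_of_above [OrderBot X] {d : ℕ} (hw : IsProperWeight d w) (hX : IsCubeComplex X)
    {u : X} {n : ℕ} {i : ℤ} (hi : i = n) (hu : fdim u ≤ n) (hn : n ≤ d) {f : Cochain F i}
    (hf : ∀ x, f x ≠ 0 → u ≤ x.1) : cnorm w f ≤ cubeCount n (fdim u) * w u := by
  rw [← hw.weightOf_up hX u hu hn, cnorm_eq_weightOf_csupp]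
  exact weightOf_mono hw.nonneg fun x ⟨h, hx⟩ => ⟨h.trans hi, hf _ hx⟩

theorem cnorm_le_one [OrderBot X] {d : ℕ} (hw : IsProperWeight d w) (hX : IsCubeComplex X)
    {n : ℕ} (hn : n ≤ d) (f : Cochain F n) : cnorm w f ≤ 1 := by
  have h := cnorm_le_of_above hw hX (u := ⊥) rfl (by rw [hX.1]; omega) hn (f := f)
    fun x _ => bot_le
  rwa [hX.1, cubeCount_neg_one, hw.bot hX, Nat.cast_one, mul_one] at h

/-- The support of the coboundary is covered by the faces above the support of f, whose weights
`IsProperWeight.weightOf_up` gives. -/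
theorem cnorm_coboundary_le [OrderBot X] {d : ℕ} (hw : IsProperWeight d w) (hX : IsCubeComplex X)
    {o : POrientation R X} {n m : ℕ} {j : ℤ} (hj : j = m) (hnm : n ≤ m) (hm : m ≤ d)
    (f : Cochain F n) :
    cnorm w (coboundary o F n j f) ≤ cubeCount m n * cnorm w f := by
  rw [cnorm_eq_weightOf_csupp, cnorm_eq_weightOf_csupp, ← weightOf_const_mul]
  refine (weightOf_le_weightOf_weightOf hw.nonneg (csupp f) (fun x y => fdim y = m ∧ x ≤ y) _
    ?_).trans (weightOf_congr ?_).le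
  · rintro y ⟨hy, h⟩
    obtain ⟨x, hx, hfx⟩ := exists_le_of_coboundary_ne_zero h
    exact ⟨x.1, ⟨x.2, hfx⟩, hy.trans hj, hx⟩
  · rintro x ⟨hx, -⟩
    rw [hw.weightOf_up hX x (by omega) hm, hx]

end Cochains

/-! ### Heavy faces -/

section Heavy

variable {X : Type uX} [PartialOrder X]

/-- Chains of faces descending through the sets `A 0, A 1, …`. -/
inductive HeavyPath (A : ℕ → Set X) : ℕ → X → X → Prop
  | base {x : X} : x ∈ A 0 → HeavyPath A 0 x x
  | step {s : ℕ} {x v u : X} : HeavyPath A s x v → u ∈ A (s + 1) → u ≤ v →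
      HeavyPath A (s + 1) x u

theorem HeavyPath.start_mem {A : ℕ → Set X} {s : ℕ} {x u : X} (h : HeavyPath A s x u) :
    x ∈ A 0 := by
  induction h with
  | base h => exact h
  | step _ _ _ ih => exact ih

theorem HeavyPath.end_mem {A : ℕ → Set X} {s : ℕ} {x u : X} (h : HeavyPath A s x u) :
    u ∈ A s := by
  cases h with
  | base h => exact h
  | step _ h _ => exact h

theorem HeavyPath.le {A : ℕ → Set X} {s : ℕ} {x u : X} (h : HeavyPath A s x u) : u ≤ x := by
  induction h with
  | base h => exact le_rfl
  | step _ _ h ih => exact h.trans ih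

/-- The faces at which descending chains stop. -/
def terminalFaces (m : ℕ) (A : ℕ → Set X) : Set X :=
  {u | ∃ s ≤ m, u ∈ A s ∧ ∀ z ∈ A (s + 1), ¬ z ≤ u}

/-- Otherwise a chain starting at x could be prolonged at each level and would reach the empty level
m + 1. -/
theorem exists_terminalFace {m : ℕ} {A : ℕ → Set X} (hempty : A (m + 1) = ∅) {x : X}
    (hx : x ∈ A 0) : ∃ u ∈ terminalFaces m A, ∃ s, HeavyPath A s x u := by
  by_contra! hcon
  have h : ∀ s, s ≤ m + 1 → ∃ u, HeavyPath A s x u := by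
    intro s
    induction s with
    | zero => exact fun _ => ⟨x, .base hx⟩
    | succ s ih =>
      intro hs
      obtain ⟨u, hu⟩ := ih (by omega)
      by_contra! hno
      exact hcon u ⟨s, by omega, hu.end_mem, fun z hz hzu => hno z (.step hu hz hzu)⟩ s hu
  obtain ⟨u, hu⟩ := h (m + 1) le_rfl
  have := hu.end_mem
  rw [hempty] at this
  exact this

variable [GradeOrder ℤ X]

/-- The faces of dimension `m - s + 1` with two distinct facets in `A s` that have a common
facet outside `A (s + 1)`. -/
def lightPairs (m : ℕ) (A : ℕ → Set X) (s : ℕ) : Set X :=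
  {c | fdim c = (m : ℤ) - s + 1 ∧ ∃ z, (fdim z = (m : ℤ) - s - 1 ∧ z ∉ A (s + 1)) ∧
    ∃ a ∈ A s, ∃ b ∈ A s, a ≠ b ∧ z ≤ a ∧ z ≤ b ∧ a ≤ c ∧ b ≤ c}

/-- The faces of dimension `m - s + 1` with two opposite facets in `A s`. -/
def oppositePairs [OrderBot X] (m : ℕ) (A : ℕ → Set X) (s : ℕ) : Set X :=
  {c | fdim c = (m : ℤ) - s + 1 ∧ s < m ∧
    ∃ a ∈ A s, ∃ b ∈ A s, a ≠ b ∧ a ≤ c ∧ b ≤ c ∧ infima {a, b} = {⊥}}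

/-- The `(m + 1)`-faces containing a light or an opposite pair. -/
def badFaces [OrderBot X] (m : ℕ) (A : ℕ → Set X) : Set X :=
  {y | fdim y = (m : ℤ) + 1 ∧ ∃ s ≤ m, ∃ c ∈ lightPairs m A s ∪ oppositePairs m A s, c ≤ y}

variable [OrderBot X]

/-- Bad faces are defined so that this holds: the facets are neither opposite nor meet in a face
that fails to be heavy, and `IsCubeComplex.facets_meet` leaves no other case. -/
theorem exists_common_facet (hX : IsCubeComplex X) {m : ℕ} {A : ℕ → Set X}
    (hA : ∀ s, ∀ x ∈ A s, fdim x = (m : ℤ) - s) {s : ℕ} (hs : s ≤ m) {a b c y : X}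
    (ha : a ∈ A s) (hb : b ∈ A s) (hab : a ≠ b) (hc : fdim c = (m : ℤ) - s + 1) (hac : a ≤ c)
    (hbc : b ≤ c) (hcy : c ≤ y) (hy : fdim y = (m : ℤ) + 1) (hbad : y ∉ badFaces m A) :
    ∃ z ∈ A (s + 1), z ≤ a ∧ z ≤ b := by
  have hms : ((m - s : ℕ) : ℤ) = (m : ℤ) - s := by omega
  obtain ⟨z, hza, hzb, hz⟩ | ⟨hi, hinf⟩ := hX.facets_meet (i := m - s)
    (by rw [hA s a ha, hms]) (by rw [hA s b hb, hms]) (by rw [hc, hms]) hac hbc hab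
  · refine ⟨z, ?_, hza, hzb⟩
    by_contra hz'
    exact hbad ⟨hy, s, hs, c, Or.inl ⟨hc, z, ⟨by rw [hz, hms], hz'⟩, a, ha, b, hb, hab, hza, hzb,
      hac, hbc⟩, hcy⟩
  · exact absurd ⟨hy, s, hs, c, Or.inr ⟨hc, by omega, a, ha, b, hb, hab, hac, hbc, hinf⟩, hcy⟩ hbad

/-- A chain from x is followed by one from x' that ends at the same face or runs one level ahead,
below it. When the first chain steps from v to u while the second is at z below v, both u and z are
facets of v, and their common facet is heavy because y is not bad. -/
theorem HeavyPath.transfer (hX : IsCubeComplex X) {m : ℕ} {A : ℕ → Set X}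
    (hA : ∀ s, ∀ x ∈ A s, fdim x = (m : ℤ) - s) {y : X} (hy : fdim y = (m : ℤ) + 1)
    (hbad : y ∉ badFaces m A) {s : ℕ} {x x' v : X} (hs : s ≤ m) (h : HeavyPath A s x v)
    (hxy : x ≤ y) (hx' : x' ∈ A 0) (hx'y : x' ≤ y) :
    HeavyPath A s x' v ∨ ∃ z ∈ A (s + 1), z ≤ v ∧ HeavyPath A (s + 1) x' z := by
  induction h with
  | @base x hx =>
    by_cases hxx : x' = x
    · subst hxx
      exact Or.inl (.base hx)
    · obtain ⟨z, hz, h1, h2⟩ := exists_common_facet hX hA hs hx' hx hxx (by simpa using hy) hx'y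
        hxy le_rfl hy hbad
      exact Or.inr ⟨z, hz, h2, .step (.base hx') hz h1⟩
  | @step s x v u hp hu huv ih =>
    obtain h | ⟨z, hz, hzv, hzp⟩ := ih (by omega) hxy
    · exact Or.inl (.step h hu huv)
    · by_cases hzu : z = u
      · subst hzu
        exact Or.inl hzp
      · obtain ⟨z', hz', h1, h2⟩ := exists_common_facet hX hA hs hz hu hzu
          (c := v) (by rw [hA s v hp.end_mem]; push_cast; ring) hzv huv (hp.le.trans hxy) hy hbad
        exact Or.inr ⟨z', hz', h2, .step hzp hz' h1⟩

/-- Around a face that is not bad, the support is all connected to the same terminal face. -/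
theorem HeavyPath.of_terminal (hX : IsCubeComplex X) {m : ℕ} {A : ℕ → Set X}
    (hA : ∀ s, ∀ x ∈ A s, fdim x = (m : ℤ) - s) {y : X} (hy : fdim y = (m : ℤ) + 1)
    (hbad : y ∉ badFaces m A) {s : ℕ} {x x' u : X} (hu : u ∈ terminalFaces m A)
    (h : HeavyPath A s x u) (hxy : x ≤ y) (hx' : x' ∈ A 0) (hx'y : x' ≤ y) :
    HeavyPath A s x' u := by
  obtain ⟨s', hs', hus', hterm⟩ := hu
  have h1 := hA s u h.end_mem
  have h2 := hA s' u hus'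
  -- The level of a heavy face is determined by its dimension.
  obtain rfl : s' = s := by omega
  obtain h' | ⟨z, hz, hzu, -⟩ := h.transfer hX hA hy hbad hs' hxy hx' hx'y
  · exact h'
  · exact absurd hzu (hterm z hz)

end Heavy

/-! ### Weights of heavy faces and of bad faces. -/

section HeavyWeights

variable {X : Type uX} [PartialOrder X] [Fintype X] [GradeOrder ℤ X]

/-- The heavy faces above a set `S` of `m`-faces: a face is heavy if a proportion at least
`t ^ 2 ^ s` of the faces covering it is. -/
noncomputable def heavyFaces (m : ℕ) (w : X → ℝ) (t : ℝ) (S : Set X) : ℕ → Set X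
  | 0 => S
  | s + 1 => {x | fdim x = (m : ℤ) - s - 1 ∧
      t ^ (2 ^ s) * weightOf w {y | fdim y = (m : ℤ) - s ∧ x ≤ y} ≤
        weightOf w {y | y ∈ heavyFaces m w t S s ∧ x ≤ y}}

theorem fdim_heavyFaces {m : ℕ} {w : X → ℝ} {t : ℝ} {S : Set X} (hS : ∀ x ∈ S, fdim x = m)
    (s : ℕ) : ∀ x ∈ heavyFaces m w t S s, fdim x = (m : ℤ) - s := by
  cases s with
  | zero => simpa [heavyFaces] using hS
  | succ s =>
    intro x hx
    rw [hx.1]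
    push_cast
    ring

variable [OrderBot X] {d m : ℕ} {w : X → ℝ} {t : ℝ} {S : Set X}

theorem card_below_le (hX : IsCubeComplex X) {y : X} {n : ℕ} (hy : fdim y = n) {i : ℤ}
    {P : X → Prop} (hP : ∀ x, P x → fdim x = i ∧ x ≤ y) :
    (Nat.card {x : X // P x} : ℝ) ≤ cubeCount n i := by
  rw [← hX.card_faces hy i]
  exact_mod_cast Nat.card_le_card_of_injective (fun x : {x : X // P x} =>
    (⟨x.1, hP x.1 x.2⟩ : {x : X // fdim x = i ∧ x ≤ y}))
    fun x x' h => Subtype.ext (congrArg (fun z => z.1) h)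

/-- Count pairs of a heavy face and a face of the previous level covering it. Heaviness bounds the
pairs from below, and each upper face has at most `cubeCount (m - s) (m - s - 1)` facets. -/
theorem weightOf_heavyFaces_succ (hw : IsProperWeight d w) (hX : IsCubeComplex X)
    (hm : m ≤ d) (hS : ∀ x ∈ S, fdim x = m) {s : ℕ} (hs : s ≤ m) :
    t ^ (2 ^ s) * weightOf w (heavyFaces m w t S (s + 1)) ≤ weightOf w (heavyFaces m w t S s) := by
  have hms : ((m - s : ℕ) : ℤ) = (m : ℤ) - s := by omega
  have hpos : (0 : ℝ) < cubeCount (m - s) ((m : ℤ) - s - 1) :=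
    Nat.cast_pos.2 (cubeCount_pos (by omega) (by omega))
  refine le_of_mul_le_mul_left ?_ hpos
  rw [← mul_assoc, ← weightOf_const_mul]
  refine le_trans ?_ (weightOf_weightOf_le hw.nonneg (heavyFaces m w t S (s + 1))
    (fun x y => y ∈ heavyFaces m w t S s ∧ x ≤ y) (heavyFaces m w t S s)
    (fun x _ y h => h.1) _ ?_)
  · refine weightOf_le_weightOf (fun _ h1 h2 => absurd h1 h2) le_rfl fun x hx => ?_
    refine le_trans (le_of_eq ?_) hx.2
    rw [← hms, hw.weightOf_up hX x (by rw [hx.1]; omega) (by omega), hx.1, hms]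
    ring
  · intro y hy
    exact card_below_le hX (by rw [fdim_heavyFaces hS s y hy, hms]) fun x hx => ⟨hx.1.1, hx.2.2⟩

/-- The losses multiply, with exponents 1 + 2 + ... + 2^(s - 1) = 2^s - 1. -/
theorem weightOf_heavyFaces (hw : IsProperWeight d w) (hX : IsCubeComplex X) (ht : 0 < t)
    (hm : m ≤ d) (hS : ∀ x ∈ S, fdim x = m) {s : ℕ} (hs : s ≤ m + 1) :
    t ^ (2 ^ s - 1) * weightOf w (heavyFaces m w t S s) ≤ weightOf w S := by
  induction s with
  | zero => simp [heavyFaces]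
  | succ s ih =>
    have h1 := Nat.one_le_two_pow (n := s)
    have e : 2 ^ (s + 1) - 1 = (2 ^ s - 1) + 2 ^ s := by rw [pow_succ]; omega
    rw [e, pow_add, mul_assoc]
    exact (mul_le_mul_of_nonneg_left (weightOf_heavyFaces_succ hw hX hm hS (by omega))
      (by positivity)).trans (ih (by omega))

/-- For each z that is not heavy, a light pair is an edge of the link of z between two vertices of a
set of weight below t^(2^s), to which skeleton expansion applies. One factor N compares weights of
edges and vertices of the link with weights in X, the other counts the z below a given face. -/
theorem weightOf_lightPairs (hw : IsProperWeight d w) (hX : IsCubeComplex X) (ht : 0 < t)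
    (hm : m + 1 ≤ d) (hS : ∀ x ∈ S, fdim x = m) {s : ℕ} (hs : s ≤ m) {N : ℝ}
    (hN : (3 : ℝ) ^ (m + 1) + 1 ≤ N)
    (hexp : ∀ z : X, fdim z = (m : ℤ) - s - 1 →
      (underlyingGraph (linkWeight d w z)).IsSkeletonExpander (t ^ (2 ^ s)) 1) :
    weightOf w (lightPairs m (heavyFaces m w t S) s) ≤
      2 * N ^ 2 * (t ^ (2 ^ s) * weightOf w (heavyFaces m w t S s)) := by
  set A := heavyFaces m w t S
  have hA : ∀ s, ∀ x ∈ A s, fdim x = (m : ℤ) - s := fdim_heavyFaces hS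
  obtain ⟨n, hn⟩ : ∃ n : ℕ, n = m - s := ⟨_, rfl⟩
  have hms : (m : ℤ) - s = n := by omega
  have hcN : ∀ j ≤ m + 1, ∀ i, (cubeCount j i : ℝ) ≤ N := by
    intro j hj i
    refine le_trans ?_ hN
    have h1 : (cubeCount j i : ℝ) ≤ 3 ^ j + 1 := by exact_mod_cast cubeCount_le j i
    have h2 : (3 : ℝ) ^ j ≤ 3 ^ (m + 1) := pow_le_pow_right₀ (by norm_num) hj
    linarith
  have hN1 : 1 ≤ N := by
    have : (0 : ℝ) ≤ 3 ^ (m + 1) := by positivity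
    linarith
  have hlocal : ∀ z ∈ {z : X | fdim z = (m : ℤ) - s - 1 ∧ z ∉ A (s + 1)},
      weightOf w {c | fdim c = (m : ℤ) - s + 1 ∧
        ∃ a ∈ A s, ∃ b ∈ A s, a ≠ b ∧ z ≤ a ∧ z ≤ b ∧ a ≤ c ∧ b ≤ c} ≤
      (2 * N * t ^ (2 ^ s)) * weightOf w {y | y ∈ A s ∧ z ≤ y} := by
    rintro z ⟨hz, hzA⟩
    have hzn : fdim z = (n : ℤ) - 1 := by rw [hz, hms]
    let T : Set (Face (Link z) 0) := {v | v.1.face ∈ A s}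
    have hT := weightOf_link hw hX z (i := 0) (j := n) (by omega) T
    have hTimg : (fun x : Face (Link z) 0 => x.1.face) '' T = {y | y ∈ A s ∧ z ≤ y} := by
      ext y
      constructor
      · rintro ⟨v, hv, rfl⟩
        exact ⟨hv, v.1.le_face⟩
      · rintro ⟨hy, hzy⟩
        exact ⟨⟨⟨y, hzy⟩, by rw [fdim_link, hA s y hy]; omega⟩, hy, rfl⟩
    rw [hTimg] at hT
    have hE := weightOf_link hw hX z (i := 1) (j := n + 1) (by push_cast; omega)
      ((underlyingGraph (linkWeight d w z)).E2 T)
    have hexpT : weightOf (fun e : Face (Link z) 1 => linkWeight d w z e.1)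
        ((underlyingGraph (linkWeight d w z)).E2 T) ≤
        t ^ (2 ^ s) * weightOf (fun v : Face (Link z) 0 => linkWeight d w z v.1) T +
        1 * weightOf (fun v : Face (Link z) 0 => linkWeight d w z v.1) T ^ 2 := hexp z hz T
    have hτ0 : 0 ≤ weightOf (fun v : Face (Link z) 0 => linkWeight d w z v.1) T :=
      weightOf_nonneg (fun v : Face (Link z) 0 => linkWeight_nonneg (w := w) hw v.1) T
    generalize weightOf (fun v : Face (Link z) 0 => linkWeight d w z v.1) T = τ at *
    have p1 : (1 : ℝ) ≤ cubeCount n (fdim z) :=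
      Nat.one_le_cast.2 (cubeCount_pos (hX.neg_one_le_fdim z) (by omega))
    have p2 := hw.pos z
    -- That z is not heavy says exactly that the vertex set has small weight in the link; this makes
    -- the quadratic term of skeleton expansion as small as the linear one.
    have hlight : τ ≤ t ^ (2 ^ s) := by
      have h1 : ¬ t ^ (2 ^ s) * weightOf w {y | fdim y = (m : ℤ) - s ∧ z ≤ y} ≤
          weightOf w {y | y ∈ A s ∧ z ≤ y} := fun h => hzA ⟨hz, h⟩
      rw [hms, hw.weightOf_up hX z (by omega) (by omega), ← hT, not_le] at h1
      exact (lt_of_mul_lt_mul_left (h1.trans_eq (mul_comm _ _)) (by positivity)).le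
    have hsub : {c | fdim c = (m : ℤ) - s + 1 ∧
        ∃ a ∈ A s, ∃ b ∈ A s, a ≠ b ∧ z ≤ a ∧ z ≤ b ∧ a ≤ c ∧ b ≤ c} ⊆
        (fun x : Face (Link z) 1 => x.1.face) ''
          ((underlyingGraph (linkWeight d w z)).E2 T : Set (Face (Link z) 1)) := by
      rintro c ⟨hc, a, ha, b, hb, hab, hza, hzb, hac, hbc⟩
      let a' : Face (Link z) 0 := ⟨⟨a, hza⟩, by rw [fdim_link, hA s a ha]; omega⟩
      let b' : Face (Link z) 0 := ⟨⟨b, hzb⟩, by rw [fdim_link, hA s b hb]; omega⟩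
      let c' : Face (Link z) 1 := ⟨⟨c, hza.trans hac⟩, by rw [fdim_link, hc]; omega⟩
      have hab' : a' ≠ b' := fun h => hab (congrArg (fun x => x.1.face) h)
      exact ⟨c', ⟨a', ha, b', hb, hab', hac, hbc, hab', c', hac, hbc⟩, rfl⟩
    refine (weightOf_mono hw.nonneg hsub).trans ?_
    rw [← hE, ← hT]
    have hsq : t ^ (2 ^ s) * τ + 1 * τ ^ 2 ≤ 2 * t ^ (2 ^ s) * τ := by nlinarith
    calc _ ≤ (cubeCount (n + 1) (fdim z) : ℝ) * w z * (2 * t ^ (2 ^ s) * τ) := by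
            gcongr
            exact hexpT.trans hsq
      _ ≤ N * w z * (2 * t ^ (2 ^ s) * τ) := by
            gcongr
            exact hcN _ (by omega) _
      _ = 2 * N * t ^ (2 ^ s) * (1 * w z * τ) := by ring
      _ ≤ _ := by gcongr
  calc weightOf w (lightPairs m A s)
      ≤ weightOf (fun z => weightOf w {c | fdim c = (m : ℤ) - s + 1 ∧
          ∃ a ∈ A s, ∃ b ∈ A s, a ≠ b ∧ z ≤ a ∧ z ≤ b ∧ a ≤ c ∧ b ≤ c})
          {z : X | fdim z = (m : ℤ) - s - 1 ∧ z ∉ A (s + 1)} := by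
        refine weightOf_le_weightOf_weightOf hw.nonneg _ _ _ ?_
        rintro c ⟨hc, z, hz, h⟩
        exact ⟨z, hz, hc, h⟩
    _ ≤ weightOf (fun z => (2 * N * t ^ (2 ^ s)) * weightOf w {y | y ∈ A s ∧ z ≤ y})
          {z : X | fdim z = (m : ℤ) - s - 1 ∧ z ∉ A (s + 1)} :=
        weightOf_le_weightOf (fun _ h1 h2 => absurd h1 h2) le_rfl hlocal
    _ ≤ (2 * N * t ^ (2 ^ s)) * (N * weightOf w (A s)) := by
        rw [weightOf_const_mul]
        refine mul_le_mul_of_nonneg_left ?_ (by positivity)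
        refine weightOf_weightOf_le hw.nonneg _ _ (A s) (fun x _ y h => h.1) _ fun y hy => ?_
        exact (card_below_le hX (n := n) (i := (m : ℤ) - s - 1) (by rw [hA s y hy, hms])
          fun x hx => ⟨hx.1.1, hx.2.2⟩).trans (hcN _ (by omega) _)
    _ = _ := by ring

theorem weightOf_oppositePairs (hw : IsProperWeight d w) (hS : ∀ x ∈ S, fdim x = m) {s : ℕ}
    {α β : ℝ}
    (hexp : s < m → (noIntersection ((m : ℤ) - s) ((m : ℤ) - s) ((m : ℤ) - s + 1)
      w).IsSkeletonExpander α β) (hα : 0 ≤ α) (hβ : 0 ≤ β) :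
    weightOf w (oppositePairs m (heavyFaces m w t S) s) ≤
      α * weightOf w (heavyFaces m w t S s) + β * weightOf w (heavyFaces m w t S s) ^ 2 := by
  set A := heavyFaces m w t S
  have hA : ∀ s, ∀ x ∈ A s, fdim x = (m : ℤ) - s := fdim_heavyFaces hS
  have hA0 := weightOf_nonneg hw.nonneg (A s)
  by_cases hsm : s < m
  · let T : Set {x : X // fdim x = (m : ℤ) - s ∨ fdim x = (m : ℤ) - s} := {v | v.1 ∈ A s}
    have h := hexp hsm T
    have hV : weightOf (noIntersection ((m : ℤ) - s) ((m : ℤ) - s) ((m : ℤ) - s + 1) w).wV T =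
        weightOf w (A s) := by
      have himg : Subtype.val '' T = A s := by
        ext x
        constructor
        · rintro ⟨v, hv, rfl⟩
          exact hv
        · intro hx
          exact ⟨⟨x, Or.inl (hA s x hx)⟩, hx, rfl⟩
      rw [← himg, weightOf_image Subtype.val_injective]
      exact weightOf_congr fun x _ => if_pos rfl
    rw [hV] at h
    refine le_trans ?_ h
    have hE : weightOf (noIntersection ((m : ℤ) - s) ((m : ℤ) - s) ((m : ℤ) - s + 1) w).wE
        ((noIntersection ((m : ℤ) - s) ((m : ℤ) - s) ((m : ℤ) - s + 1) w).E2 T) =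
        weightOf w (Subtype.val '' ((noIntersection ((m : ℤ) - s) ((m : ℤ) - s)
          ((m : ℤ) - s + 1) w).E2 T : Set (Face X ((m : ℤ) - s + 1)))) :=
      (weightOf_image Subtype.val_injective _ _).symm
    rw [hE]
    refine weightOf_mono hw.nonneg ?_
    rintro c ⟨hc, -, a, ha, b, hb, hab, hac, hbc, hinf⟩
    exact ⟨⟨c, hc⟩, ⟨⟨a, Or.inl (hA s a ha)⟩, ha, ⟨b, Or.inl (hA s b hb)⟩, hb,
      fun h => hab (congrArg Subtype.val h), hac, hbc, ⟨⟨c, hc⟩, hac, hbc⟩, hinf,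
      Or.inl ⟨hA s a ha, hA s b hb⟩⟩, rfl⟩
  -- At the last level the faces are vertices, and pairs of vertices are handled through their
  -- common facet ∅ instead.
  · have : oppositePairs m A s = ∅ := Set.eq_empty_of_forall_notMem fun c hc => hsm hc.2.1
    rw [this, weightOf_empty]
    positivity

/-- The bad faces weigh little. -/
theorem weightOf_badFaces (hw : IsProperWeight d w) (hX : IsCubeComplex X) (ht : 0 < t)
    (hm : m + 1 ≤ d) (hS : ∀ x ∈ S, fdim x = m) {N B : ℝ}
    (hN : (3 : ℝ) ^ (m + 1) + 1 ≤ N) (hB : 1 ≤ B)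
    (hlink : ∀ s ≤ m, ∀ z : X, fdim z = (m : ℤ) - s - 1 →
      (underlyingGraph (linkWeight d w z)).IsSkeletonExpander (t ^ (2 ^ s)) 1)
    (hopp : ∀ s < m, (noIntersection ((m : ℤ) - s) ((m : ℤ) - s) ((m : ℤ) - s + 1)
      w).IsSkeletonExpander (t ^ (2 ^ s)) (B * (t ^ (2 ^ (m + 1) - 2 ^ (s + 1)))⁻¹))
    (hsmall : weightOf w S < B⁻¹ * t ^ (2 ^ (m + 1) - 1)) :
    weightOf w (badFaces m (heavyFaces m w t S)) ≤
      4 * (m + 1) * N ^ 3 * t * weightOf w S := by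
  set A := heavyFaces m w t S with hAdef
  have hN1 : 1 ≤ N := by
    have : (0 : ℝ) ≤ 3 ^ (m + 1) := by positivity
    linarith
  have hM0 := weightOf_nonneg hw.nonneg S
  have hpair : ∀ s ≤ m, weightOf w (lightPairs m A s ∪ oppositePairs m A s) ≤
      4 * N ^ 2 * t * weightOf w S := by
    intro s hs
    have h2s := Nat.one_le_two_pow (n := s)
    have hA0 := weightOf_nonneg hw.nonneg (A s)
    have hw1 : t ^ (2 ^ s - 1) * weightOf w (A s) ≤ weightOf w S :=
      weightOf_heavyFaces hw hX ht (by omega) hS (by omega)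
    have h1 : t ^ (2 ^ s) * weightOf w (A s) ≤ t * weightOf w S := by
      have e : 2 ^ s = (2 ^ s - 1) + 1 := by omega
      rw [e, pow_succ, mul_comm _ t, mul_assoc]
      gcongr
    have h2 : B * (t ^ (2 ^ (m + 1) - 2 ^ (s + 1)))⁻¹ * weightOf w (A s) ^ 2 ≤
        t * weightOf w S := by
      have hle : 2 ^ (s + 1) ≤ 2 ^ (m + 1) := Nat.pow_le_pow_right (by norm_num) (by omega)
      -- The smallness exponent pays for two factors t^(2^s - 1) from w(A s)^2, for the negative
      -- power of t in the expansion hypothesis, and leaves one factor t.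
      have e : 2 ^ (m + 1) - 1 = ((2 ^ s - 1) + (2 ^ s - 1)) + 1 + (2 ^ (m + 1) - 2 ^ (s + 1)) := by
        rw [pow_succ 2 s] at hle ⊢
        omega
      have hsq : (t ^ (2 ^ s - 1) * weightOf w (A s)) * (t ^ (2 ^ s - 1) * weightOf w (A s)) ≤
          weightOf w S * (B⁻¹ * t ^ (2 ^ (m + 1) - 1)) :=
        mul_le_mul hw1 (hw1.trans hsmall.le) (by positivity) hM0
      rw [e, pow_add, pow_add, pow_add, pow_one] at hsq
      have hP : 0 < t ^ (2 ^ s - 1) := by positivity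
      have hQ : 0 < t ^ (2 ^ (m + 1) - 2 ^ (s + 1)) := by positivity
      generalize t ^ (2 ^ s - 1) = P at *
      generalize t ^ (2 ^ (m + 1) - 2 ^ (s + 1)) = Q at *
      have hB0 : 0 < B := by linarith
      rw [← div_eq_mul_inv, div_mul_eq_mul_div, div_le_iff₀ hQ]
      have : P * P * weightOf w (A s) ^ 2 * B ≤ P * P * (t * weightOf w S * Q) := by
        calc _ = P * weightOf w (A s) * (P * weightOf w (A s)) * B := by ring
          _ ≤ weightOf w S * (B⁻¹ * (P * P * t * Q)) * B := by gcongr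
          _ = P * P * (t * weightOf w S * Q) * (B⁻¹ * B) := by ring
          _ = _ := by rw [inv_mul_cancel₀ hB0.ne', mul_one]
      have hPP : 0 < P * P := by positivity
      nlinarith [le_of_mul_le_mul_left (a := P * P) (b := B * weightOf w (A s) ^ 2)
        (c := t * weightOf w S * Q) (by linarith) hPP]
    calc weightOf w (lightPairs m A s ∪ oppositePairs m A s)
        ≤ 2 * N ^ 2 * (t ^ (2 ^ s) * weightOf w (A s)) +
          (t ^ (2 ^ s) * weightOf w (A s) +
            B * (t ^ (2 ^ (m + 1) - 2 ^ (s + 1)))⁻¹ * weightOf w (A s) ^ 2) :=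
          (weightOf_union_le hw.nonneg _ _).trans (add_le_add
            (weightOf_lightPairs hw hX ht hm hS hs hN (hlink s hs))
            (weightOf_oppositePairs hw hS (hopp s) (by positivity) (by positivity)))
      _ ≤ 2 * N ^ 2 * (t * weightOf w S) + (t * weightOf w S + t * weightOf w S) := by gcongr
      _ = (2 * N ^ 2 + 2) * (t * weightOf w S) := by ring
      _ ≤ (4 * N ^ 2) * (t * weightOf w S) := by
          gcongr
          nlinarith
      _ = _ := by ring
  have hcover : badFaces m A ⊆ ⋃ s ∈ Finset.range (m + 1), {y | ∃ c ∈ lightPairs m A s ∪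
      oppositePairs m A s, fdim y = (m + 1 : ℕ) ∧ c ≤ y} := by
    rintro y ⟨hy, s, hs, c, hc, hcy⟩
    exact Set.mem_biUnion (show s ∈ Finset.range (m + 1) from Finset.mem_range.2 (by omega))
      ⟨c, hc, by rw [hy]; push_cast; rfl, hcy⟩
  have hone : ∀ s ∈ Finset.range (m + 1), weightOf w {y | ∃ c ∈ lightPairs m A s ∪
      oppositePairs m A s, fdim y = (m + 1 : ℕ) ∧ c ≤ y} ≤ N * (4 * N ^ 2 * t * weightOf w S) := by
    intro s hs
    have hs' : s ≤ m := by
      have := Finset.mem_range.1 hs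
      omega
    refine (weightOf_le_weightOf_weightOf hw.nonneg (lightPairs m A s ∪ oppositePairs m A s)
      (fun c y => fdim y = (m + 1 : ℕ) ∧ c ≤ y) _ fun y hy => hy).trans ?_
    refine le_trans (b := N * weightOf w (lightPairs m A s ∪ oppositePairs m A s)) ?_
      (mul_le_mul_of_nonneg_left (hpair s hs') (by linarith))
    rw [← weightOf_const_mul]
    refine weightOf_le_weightOf (fun _ h1 h2 => absurd h1 h2) le_rfl fun c hc => ?_
    have hcd : fdim c = (m : ℤ) - s + 1 := by
      rcases hc with hc | hc
      · exact hc.1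
      · exact hc.1
    rw [hw.weightOf_up hX c (by rw [hcd]; push_cast; omega) hm]
    refine mul_le_mul_of_nonneg_right (le_trans ?_ hN) (hw.nonneg c)
    exact_mod_cast cubeCount_le _ _
  refine (weightOf_mono hw.nonneg hcover).trans
    ((weightOf_iUnion_le hw.nonneg _ _).trans ((Finset.sum_le_sum hone).trans (le_of_eq ?_)))
  rw [Finset.sum_const, Finset.card_range, nsmul_eq_mul]
  push_cast
  ring

end HeavyWeights

/-! ### Small locally minimal cocycles vanish -/

section LocallyMinimal

variable {R : Type uR} [CommRing R] {X : Type uX} [PartialOrder X] [GradeOrder ℤ X]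
  {F : PosetSheaf.{uR, uX, uM} R X}

open Classical in
/-- The restriction of a cochain to a set of faces, extended by zero. -/
noncomputable def cutoff {i : ℤ} (f : Cochain F i) (D : Set X) : Cochain F i :=
  fun x => if x.1 ∈ D then f x else 0

theorem csupp_cutoff {i : ℤ} (f : Cochain F i) (D : Set X) :
    csupp (cutoff f D) = csupp f ∩ D := by
  ext x
  constructor
  · rintro ⟨h, hx⟩
    by_cases hD : x ∈ D
    · refine ⟨⟨h, ?_⟩, hD⟩
      simpa [cutoff, hD] using hx
    · simp [cutoff, hD] at hx
  · rintro ⟨⟨h, hx⟩, hD⟩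
    exact ⟨h, by simpa [cutoff, hD] using hx⟩

variable [Fintype X] {w : X → ℝ} {o : POrientation R X}

/-- Cutting off preserves local minimality. -/
theorem cnorm_cutoff_sub_le (hw : ∀ x, 0 ≤ w x) {i : ℤ} (f h : Cochain F i) (D : Set X) {c : ℝ}
    (hc : cnorm w f - c ≤ cnorm w (f - h)) :
    cnorm w (cutoff f D) - c ≤ cnorm w (cutoff f D - h) := by
  have h1 : cnorm w f = cnorm w (cutoff f D) + cnorm w (f - cutoff f D) := by
    have e : csupp (f - cutoff f D) = csupp f \ D := by
      ext x
      constructor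
      · rintro ⟨hx, hne⟩
        by_cases hD : x ∈ D
        · simp [cutoff, hD] at hne
        · exact ⟨⟨hx, by simpa [cutoff, hD] using hne⟩, hD⟩
      · rintro ⟨⟨hx, hne⟩, hD⟩
        exact ⟨hx, by simpa [cutoff, hD] using hne⟩
    rw [cnorm_eq_weightOf_csupp, cnorm_eq_weightOf_csupp, cnorm_eq_weightOf_csupp, e,
      csupp_cutoff, ← weightOf_union (Set.disjoint_left.2 fun x h1 h2 => h2.2 h1.2),
      Set.inter_union_sdiff]
  -- Restoring the part of f outside D costs at most its own norm, wherever h is supported.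
  have h2 : cnorm w (f - h) ≤ cnorm w (cutoff f D - h) + cnorm w (f - cutoff f D) := by
    have e : f - h = (cutoff f D - h) + (f - cutoff f D) := by abel
    rw [e]
    exact cnorm_add_le hw _ _
  linarith

variable [OrderBot X]

/-- The coboundary of the part of a cocycle connected to a terminal face lives on bad faces. -/
theorem csupp_coboundary_cutoff (hX : IsCubeComplex X) {m : ℕ} {A : ℕ → Set X}
    (hA : ∀ s, ∀ x ∈ A s, fdim x = (m : ℤ) - s) {f : Cochain F m} (hf : f ∈ cocycles o F m)
    (hA0 : A 0 = csupp f) {u : X} (hu : u ∈ terminalFaces m A) :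
    csupp (coboundary o F m (m + 1) (cutoff f {x | ∃ s, HeavyPath A s x u})) ⊆
      {y | y ∈ badFaces m A ∧ u ≤ y} := by
  rintro y ⟨hy, hne⟩
  have hpath : ∀ x : Face X m, cutoff f {x | ∃ s, HeavyPath A s x u} x ≠ 0 →
      ∃ s, HeavyPath A s x.1 u := by
    intro x hx
    have := (mem_csupp x).2 hx
    rw [csupp_cutoff] at this
    exact this.2
  obtain ⟨x, hxy, hx⟩ := exists_le_of_coboundary_ne_zero hne
  obtain ⟨s, hs⟩ := hpath x hx
  refine ⟨?_, hs.le.trans hxy⟩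
  by_contra hbad
  refine hne ?_
  -- Below y, which is not bad, every face of the support also has a chain to u, so the cutoff
  -- agrees with the cocycle f there.
  rw [coboundary_congr (g := f)]
  · exact congrFun (LinearMap.mem_ker.1 hf) ⟨y, hy⟩
  · intro x' hx'y
    by_cases hx' : f x' = 0
    · simp [cutoff, hx']
    · refine if_pos ⟨s, ?_⟩
      exact hs.of_terminal hX hA hy hbad hu hxy (hA0 ▸ (mem_csupp x').2 hx') hx'y

/-- The local estimate: coboundary expansion of the link of `u` applied to the part of `f` above
`u` cut out by `D`. -/
theorem cnorm_cutoff_le {d m : ℕ} (hw : IsProperWeight d w) (hX : IsCubeComplex X)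
    {l : ℤ} (hl : l + 1 = m) {q ε N : ℝ} (hN : (3 : ℝ) ^ (m + 1) + 1 ≤ N) (hε : 0 ≤ ε) (hq : 0 ≤ q)
    {f : Cochain F m} {u : X} (hu : fdim u ≤ m) {D : Set X} (hD : ∀ x ∈ D, u ≤ x)
    (hcbe : ∀ j : ℤ, j = m - fdim u - 1 → ∀ g : Cochain (F.link u) j,
      ε * cdist (linkWeight d w u) g (coboundaries (o.link u) (F.link u) j) ≤
        cnorm (linkWeight d w u) (coboundary (o.link u) (F.link u) j (j + 1) g))
    (hmin : fdim u ≤ l → ∀ (j : ℤ) (hj : j = l - fdim u - 1) (g : Cochain (F.link u) j),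
      cnorm w f - q * w u ≤ cnorm w (f - coboundary o F l m (extendZero u hj g))) :
    ε * (cnorm w (cutoff f D) - q * w u) ≤
      N * cnorm w (coboundary o F m (m + 1) (cutoff f D)) := by
  have hnn := hw.nonneg
  have hN0 : 0 ≤ N := le_trans (by positivity) hN
  have habove : ∀ x, cutoff f D x ≠ 0 → u ≤ x.1 := by
    intro x hx
    have := (mem_csupp x).2 hx
    rw [csupp_cutoff] at this
    exact hD _ this.2
  have habove' : ∀ y, coboundary o F m (m + 1) (cutoff f D) y ≠ 0 → u ≤ y.1 :=
    fun y hy => le_of_coboundary_ne_zero habove hy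
  have hu' : fdim u ≤ (m + 1 : ℕ) := by push_cast; omega
  have c1 := cubeCount_cast_pos hX hu
  have c1N : (cubeCount m (fdim u) : ℝ) ≤ N := by
    refine le_trans ?_ hN
    have h1 : (cubeCount m (fdim u) : ℝ) ≤ 3 ^ m + 1 := by exact_mod_cast cubeCount_le m _
    have h2 : (3 : ℝ) ^ m ≤ 3 ^ (m + 1) := pow_le_pow_right₀ (by norm_num) (by omega)
    linarith
  have c2 : (1 : ℝ) ≤ cubeCount (m + 1) (fdim u) :=
    Nat.one_le_cast.2 (cubeCount_pos (hX.neg_one_le_fdim u) hu')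
  have hwu := hw.pos u
  by_cases hneg : cnorm w (cutoff f D) - q * w u ≤ 0
  · exact (mul_nonpos_of_nonneg_of_nonpos hε hneg).trans
      (mul_nonneg hN0 (cnorm_nonneg hnn _))
  push Not at hneg
  have hj : (m : ℤ) - fdim u - 1 = (m : ℤ) - fdim u - 1 := rfl
  have hj' : (m : ℤ) - fdim u - 1 + 1 = ((m : ℤ) + 1) - fdim u - 1 := by ring
  -- A coboundary in the link extends by zero to the coboundary in X of a cochain above u, so local
  -- minimality bounds the distance to coboundaries from below.
  have hdist : (cnorm w (cutoff f D) - q * w u) / (cubeCount m (fdim u) * w u) ≤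
      cdist (linkWeight d w u) (restrictLink u hj (cutoff f D))
        (coboundaries (o.link u) (F.link u) ((m : ℤ) - fdim u - 1)) := by
    refine le_cdist fun g hg => ?_
    obtain ⟨g', rfl⟩ := LinearMap.mem_range.1 hg
    have hjl : (m : ℤ) - fdim u - 1 - 1 = l - fdim u - 1 := by omega
    have habx : ∀ x, extendZero u hjl g' x ≠ 0 → u ≤ x.1 := fun x hx => le_of_extendZero_ne_zero hx
    have hg' : coboundary (o.link u) (F.link u) ((m : ℤ) - fdim u - 1 - 1) ((m : ℤ) - fdim u - 1)
        g' = restrictLink u hj (coboundary o F l m (extendZero u hjl g')) := by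
      rw [← coboundary_link hjl hj habx, restrictLink_extendZero]
    have hsub : restrictLink u hj (cutoff f D) - restrictLink u hj
        (coboundary o F l m (extendZero u hjl g')) =
        restrictLink u hj (cutoff f D - coboundary o F l m (extendZero u hjl g')) := rfl
    have hab2 : ∀ x, (cutoff f D - coboundary o F l m (extendZero u hjl g')) x ≠ 0 → u ≤ x.1 := by
      intro x hx
      by_contra hux
      have e1 : cutoff f D x = 0 := by_contra fun h => hux (habove x h)
      have e2 : coboundary o F l m (extendZero u hjl g') x = 0 :=
        by_contra fun h => hux (le_of_coboundary_ne_zero habx h)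
      exact hx (by rw [Pi.sub_apply, e1, e2, sub_zero])
    rw [hg', hsub, div_le_iff₀ (by positivity), mul_comm _ ((cubeCount m (fdim u) : ℝ) * w u),
      cnorm_link hw hX rfl hj hab2]
    refine cnorm_cutoff_sub_le hnn f _ D ?_
    -- If dim u = m, there are no l-faces above u, and the cochain to subtract is zero.
    by_cases hul : fdim u ≤ l
    · exact hmin hul _ hjl g'
    · have : extendZero u hjl g' = 0 := by
        funext x
        by_contra hx
        have := fdim_le_fdim (habx x hx)
        rw [x.2] at this
        omega
      rw [this, map_zero, sub_zero]
      have := mul_nonneg hq hwu.le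
      linarith
  have hexp := hcbe _ hj (restrictLink u hj (cutoff f D))
  rw [coboundary_link hj hj' habove] at hexp
  have hnorm := cnorm_link hw hX (n := m + 1) (by push_cast; rfl) hj' habove'
  rw [← hnorm]
  set Z := cnorm (linkWeight d w u)
    (restrictLink u hj' (coboundary o F m (m + 1) (cutoff f D)))
  have hZ : 0 ≤ Z := cnorm_nonneg (fun x => linkWeight_nonneg hw x) _
  calc ε * (cnorm w (cutoff f D) - q * w u)
      = (cubeCount m (fdim u) * w u) *
        (ε * ((cnorm w (cutoff f D) - q * w u) / (cubeCount m (fdim u) * w u))) := by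
        field_simp
    _ ≤ (cubeCount m (fdim u) * w u) * Z := by
        refine mul_le_mul_of_nonneg_left (le_trans ?_ hexp) (by positivity)
        exact mul_le_mul_of_nonneg_left hdist hε
    _ ≤ N * w u * Z := by gcongr
    _ = N * (1 * w u * Z) := by ring
    _ ≤ _ := by gcongr

/-- Small locally minimal cocycles vanish. -/
theorem eq_zero_of_locally_minimal {d m : ℕ} (hw : IsProperWeight d w) (hX : IsCubeComplex X)
    (hm : m + 1 ≤ d) {i l : ℤ} (hi : i = m) (hl : l + 1 = i) {t q ε N B K : ℝ}
    (hN : (3 : ℝ) ^ (m + 1) + 1 ≤ N) (hε : 0 < ε) (hq : 0 ≤ q) (hB : 1 ≤ B)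
    (ht : t = K * ε) (hK : 0 < K) (hK1 : 8 * (m + 1) * N ^ 5 * K < 1) (ht1 : t ≤ 1)
    (hqt : 2 * (m + 1) * q ≤ t ^ (2 ^ m - 1))
    (hcbe : ∀ u : X, 0 ≤ fdim u → fdim u ≤ m → ∀ j : ℤ, j = m - fdim u - 1 →
      ∀ g : Cochain (F.link u) j,
      ε * cdist (linkWeight d w u) g (coboundaries (o.link u) (F.link u) j) ≤
        cnorm (linkWeight d w u) (coboundary (o.link u) (F.link u) j (j + 1) g))
    (hlink : ∀ s ≤ m, ∀ z : X, fdim z = (m : ℤ) - s - 1 →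
      (underlyingGraph (linkWeight d w z)).IsSkeletonExpander (t ^ (2 ^ s)) 1)
    (hopp : ∀ s < m, (noIntersection ((m : ℤ) - s) ((m : ℤ) - s) ((m : ℤ) - s + 1)
      w).IsSkeletonExpander (t ^ (2 ^ s)) (B * (t ^ (2 ^ (m + 1) - 2 ^ (s + 1)))⁻¹))
    {f : Cochain F i} (hf : f ∈ cocycles o F i)
    (hsmall : cnorm w f < B⁻¹ * t ^ (2 ^ (m + 1) - 1))
    (hmin : ∀ u : X, 0 ≤ fdim u → fdim u ≤ l → ∀ (j : ℤ) (hj : j = l - fdim u - 1)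
      (g : Cochain (F.link u) j),
      cnorm w f - q * w u ≤ cnorm w (f - coboundary o F l i (extendZero u hj g))) :
    f = 0 := by
  subst hi
  have hnn := hw.nonneg
  have ht0 : 0 < t := by rw [ht]; positivity
  have hN1 : 1 ≤ N := by
    have : (0 : ℝ) ≤ 3 ^ (m + 1) := by positivity
    linarith
  set A := heavyFaces m w t (csupp f) with hAdef
  have hS : ∀ x ∈ csupp f, fdim x = m := fun x hx => hx.1
  have hA : ∀ s, ∀ x ∈ A s, fdim x = (m : ℤ) - s := fdim_heavyFaces hS
  have hM0 := cnorm_nonneg hnn f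
  have hMw := cnorm_eq_weightOf_csupp w f
  -- Only ∅, of weight 1, could be in A (m + 1), and then ‖f‖ would be at least t^(2^(m + 1) - 1).
  have hempty : A (m + 1) = ∅ := by
    refine Set.eq_empty_of_forall_notMem fun x hx => ?_
    have hxb : x = ⊥ := hX.eq_bot (by rw [hA _ x hx]; push_cast; ring)
    subst hxb
    have h1 := weightOf_heavyFaces (t := t) hw hX ht0 (by omega) hS (le_refl (m + 1))
    have h2 : weightOf w {⊥} ≤ weightOf w (A (m + 1)) :=
      weightOf_mono hnn (Set.singleton_subset_iff.2 hx)
    have h3 : weightOf w {(⊥ : X)} = 1 := by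
      rw [← hw.bot hX, weightOf, Finset.sum_eq_single ⊥]
      · exact if_pos rfl
      · exact fun b _ hb => if_neg hb
      · exact fun h => absurd (Finset.mem_univ _) h
    have h4 : B⁻¹ * t ^ (2 ^ (m + 1) - 1) ≤ t ^ (2 ^ (m + 1) - 1) :=
      mul_le_of_le_one_left (by positivity) (inv_le_one_of_one_le₀ hB)
    have h5 : t ^ (2 ^ (m + 1) - 1) * 1 ≤ t ^ (2 ^ (m + 1) - 1) * weightOf w (A (m + 1)) := by
      gcongr
      linarith
    linarith
  set U := terminalFaces m A with hU
  have hUdim : ∀ u ∈ U, 0 ≤ fdim u ∧ fdim u ≤ m := by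
    rintro u ⟨s, hs, hu, -⟩
    have := hA s u hu
    omega
  let D : X → Set X := fun u => {x | ∃ s, HeavyPath A s x u}
  have hDsupp : ∀ u, {x | ∃ s, HeavyPath A s x u} = csupp (cutoff f (D u)) := by
    intro u
    rw [csupp_cutoff]
    ext x
    exact ⟨fun h => ⟨h.choose_spec.start_mem, h⟩, fun h => h.2⟩
  -- The parts of f attached to the terminal faces cover its support, possibly with overlaps.
  have hcover : cnorm w f ≤ weightOf (fun u => cnorm w (cutoff f (D u))) U := by
    rw [hMw]
    refine (weightOf_le_weightOf_weightOf hnn U (fun u x => ∃ s, HeavyPath A s x u) (csupp f)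
      fun x hx => exists_terminalFace hempty hx).trans (le_of_eq (weightOf_congr fun u _ => ?_))
    rw [hDsupp, cnorm_eq_weightOf_csupp]
  have hlocal : ∀ u ∈ U, ε * cnorm w (cutoff f (D u)) ≤
      ε * q * w u + N * weightOf w {y | y ∈ badFaces m A ∧ u ≤ y} := by
    intro u hu
    obtain ⟨hu0, hum⟩ := hUdim u hu
    have h1 := cnorm_cutoff_le hw hX hl hN hε.le hq hum (f := f) (o := o) (D := D u)
      (fun x ⟨s, hs⟩ => hs.le) (hcbe u hu0 hum) (hmin u hu0)
    have h2 : cnorm w (coboundary o F m (m + 1) (cutoff f (D u))) ≤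
        weightOf w {y | y ∈ badFaces m A ∧ u ≤ y} := by
      rw [cnorm_eq_weightOf_csupp]
      exact weightOf_mono hnn (csupp_coboundary_cutoff hX hA hf rfl hu)
    have h3 := mul_le_mul_of_nonneg_left h2 (zero_le_one.trans hN1)
    linarith
  -- A bad face is counted once for each terminal face below it, and an (m + 1)-cube has at most N
  -- faces.
  have hbadsum : weightOf (fun u => weightOf w {y | y ∈ badFaces m A ∧ u ≤ y}) U ≤
      N * weightOf w (badFaces m A) := by
    refine weightOf_weightOf_le hnn U _ (badFaces m A) (fun u _ y h => h.1) N fun y hy => ?_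
    refine le_trans ?_ hN
    have h1 := hX.card_faces_le (y := y) (n := m + 1) (by rw [hy.1]; push_cast; rfl)
    have h2 : Nat.card {u : X // u ∈ U ∧ (y ∈ badFaces m A ∧ u ≤ y)} ≤
        Nat.card {x : X // x ≤ y} :=
      Nat.card_le_card_of_injective (fun u => (⟨u.1, u.2.2.2⟩ : {x : X // x ≤ y}))
        fun u u' h => Subtype.ext (congrArg (fun z => z.1) h)
    rw [h1] at h2
    exact_mod_cast h2
  -- The parameter q is small enough for the errors q w(u) to absorb at most half of ‖f‖, since
  -- terminal faces are heavy on one of m + 1 levels.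
  have hUw : q * weightOf w U ≤ cnorm w f / 2 := by
    have hsub : U ⊆ ⋃ s ∈ Finset.range (m + 1), A s := by
      rintro u ⟨s, hs, hu, -⟩
      exact Set.mem_biUnion (show s ∈ Finset.range (m + 1) from Finset.mem_range.2 (by omega)) hu
    have h1 : ∀ s ∈ Finset.range (m + 1), t ^ (2 ^ m - 1) * weightOf w (A s) ≤ cnorm w f := by
      intro s hs
      have hs' : s ≤ m := by
        have := Finset.mem_range.1 hs
        omega
      rw [hMw]
      refine le_trans ?_ (weightOf_heavyFaces (t := t) hw hX ht0 (by omega) hS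
        (show s ≤ m + 1 by omega))
      refine mul_le_mul_of_nonneg_right ?_ (weightOf_nonneg hnn _)
      exact pow_le_pow_of_le_one ht0.le ht1
        (Nat.sub_le_sub_right (Nat.pow_le_pow_right (by norm_num) hs') 1)
    have h2 : t ^ (2 ^ m - 1) * weightOf w U ≤ (m + 1) * cnorm w f := by
      calc _ ≤ t ^ (2 ^ m - 1) * ∑ s ∈ Finset.range (m + 1), weightOf w (A s) := by
            gcongr
            exact (weightOf_mono hnn hsub).trans (weightOf_iUnion_le hnn _ _)
        _ = ∑ s ∈ Finset.range (m + 1), t ^ (2 ^ m - 1) * weightOf w (A s) := Finset.mul_sum _ _ _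
        _ ≤ ∑ s ∈ Finset.range (m + 1), cnorm w f := Finset.sum_le_sum h1
        _ = _ := by simp
    have hU0 := weightOf_nonneg hnn U
    have h3 : 2 * (m + 1) * q * weightOf w U ≤ t ^ (2 ^ m - 1) * weightOf w U := by gcongr
    have hm1 : (0 : ℝ) < m + 1 := by positivity
    have h4 : (m + 1) * (2 * (q * weightOf w U)) ≤ (m + 1) * cnorm w f := by linarith
    have := le_of_mul_le_mul_left h4 hm1
    linarith
  have hbad := weightOf_badFaces hw hX ht0 hm hS hN hB hlink hopp (hMw ▸ hsmall)
  -- In N^5, one factor is from the estimate in links, one from the multiplicity of bad faces, three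
  -- from their weight. As t = Kε, the factor ε cancels.
  have htotal : ε * cnorm w f ≤ ε * (cnorm w f / 2) + N * (N * (4 * (m + 1) * N ^ 3 * t *
      cnorm w f)) := by
    calc ε * cnorm w f ≤ ε * weightOf (fun u => cnorm w (cutoff f (D u))) U := by gcongr
      _ = weightOf (fun u => ε * cnorm w (cutoff f (D u))) U := (weightOf_const_mul _ _ _).symm
      _ ≤ weightOf (fun u => ε * q * w u + N * weightOf w {y | y ∈ badFaces m A ∧ u ≤ y}) U :=
          weightOf_le_weightOf (fun _ h1 h2 => absurd h1 h2) le_rfl hlocal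
      _ = ε * (q * weightOf w U) +
          N * weightOf (fun u => weightOf w {y | y ∈ badFaces m A ∧ u ≤ y}) U := by
          rw [weightOf_add, weightOf_const_mul, weightOf_const_mul]
          ring
      _ ≤ _ := by
          rw [← hMw] at hbad
          gcongr
          exact hbadsum.trans (by gcongr)
  refine eq_zero_of_cnorm_eq_zero hw.pos (le_antisymm ?_ hM0)
  rw [ht] at htotal
  have h1 : ε * ((1 - 8 * (m + 1) * N ^ 5 * K) * cnorm w f) ≤ 0 := by linarith
  have h2 : (1 - 8 * (m + 1) * N ^ 5 * K) * cnorm w f ≤ 0 := nonpos_of_mul_nonpos_right h1 hε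
  exact nonpos_of_mul_nonpos_right h2 (by linarith)

end LocallyMinimal

/-! ### The correction algorithm -/

section Algorithm

variable {R : Type uR} [CommRing R] {X : Type uX} [PartialOrder X] [Fintype X]
  [GradeOrder ℤ X] {F : PosetSheaf.{uR, uX, uM} R X} {w : X → ℝ} {o : POrientation R X}

/-- The norm takes finitely many values, so that it cannot decrease forever. -/
theorem wellFounded_cnorm_lt (w : X → ℝ) (i : ℤ) :
    WellFounded fun f g : Cochain F i => cnorm w f < cnorm w g := by
  have h : WellFounded fun S T : Set X => weightOf w S < weightOf w T :=
    haveI : Std.Irrefl fun S T : Set X => weightOf w S < weightOf w T := ⟨fun _ => lt_irrefl _⟩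
    haveI : IsTrans (Set X) fun S T : Set X => weightOf w S < weightOf w T :=
      ⟨fun _ _ _ => lt_trans⟩
    Finite.wellFounded_of_trans_of_irrefl _
  refine Subrelation.wf ?_ (InvImage.wf (fun f : Cochain F i => csupp f) h)
  intro f g hfg
  rwa [cnorm_eq_weightOf_csupp, cnorm_eq_weightOf_csupp] at hfg

/-- Each round strictly lowers ‖df‖, which depends only on a support and so takes finitely many
values. -/
theorem correctionStops (hw : ∀ x, 0 ≤ w x) {k : ℤ} {q : ℝ} (hq : 0 ≤ q) (f : Cochain F k) :
    CorrectionStops w o F k q f := by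
  refine Subrelation.accessible (r := InvImage (fun f g : Cochain F (k + 1) =>
    cnorm w f < cnorm w g) (coboundary o F k (k + 1))) ?_
    ((InvImage.wf _ (wellFounded_cnorm_lt w (k + 1))).apply f)
  rintro f' f ⟨u, -, -, g, h, rfl⟩
  have := mul_nonneg hq (hw u)
  show cnorm w (coboundary o F k (k + 1) (f + extendLink u g)) < _
  rw [map_add]
  linarith

theorem exists_correctionReturns {k : ℤ} {q : ℝ} {f : Cochain F k}
    (h : CorrectionStops w o F k q f) : ∃ f', CorrectionReturns w o F k q f f' := by
  induction h with
  | intro f _ ih =>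
    by_cases hstep : ∃ f'', CorrectionStep w o F k q f f''
    · obtain ⟨f'', hf''⟩ := hstep
      obtain ⟨f', h1, h2⟩ := ih f'' hf''
      exact ⟨f', h1.head hf'', h2⟩
    · exact ⟨f, .refl, hstep⟩

/-- A round changes f only above u, hence by at most N w(u), and lowers ‖df‖ by more than q w(u).
These bounds add up along the run. -/
theorem cnorm_sub_le_of_correction [OrderBot X] {d k : ℕ} (hw : IsProperWeight d w)
    (hX : IsCubeComplex X) (hk : k ≤ d) {q N : ℝ} (hq : 0 ≤ q) (hN : (3 : ℝ) ^ k + 1 ≤ N) {f f' : Cochain F k}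
    (h : Relation.ReflTransGen (CorrectionStep w o F k q) f f') :
    q * cnorm w (f - f') ≤
      N * (cnorm w (coboundary o F k (k + 1) f) - cnorm w (coboundary o F k (k + 1) f')) := by
  have hN0 : 0 ≤ N := le_trans (by positivity) hN
  induction h with
  | refl => simp [cnorm_zero]
  | @tail f₁ f₂ _ hstep ih =>
    obtain ⟨u, hu0, huk, g, hlt, rfl⟩ := hstep
    have hg : cnorm w (extendLink u g) ≤ N * w u := by
      refine (cnorm_le_of_above hw hX rfl huk hk (u := u) (f := extendLink u g)
        fun x hx => le_of_extendZero_ne_zero (hj := rfl) hx).trans ?_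
      refine mul_le_mul_of_nonneg_right (le_trans ?_ hN) (hw.nonneg u)
      exact_mod_cast cubeCount_le _ _
    have htri : cnorm w (f - (f₁ + extendLink u g)) ≤
        cnorm w (f - f₁) + cnorm w (extendLink u g) := by
      have e : f - (f₁ + extendLink u g) = (f - f₁) + -extendLink u g := by abel
      rw [e, ← cnorm_neg w (extendLink u g)]
      exact cnorm_add_le hw.nonneg _ _
    rw [map_add]
    have h1 := mul_le_mul_of_nonneg_left (htri.trans (add_le_add_right hg _)) hq
    have h2 := mul_le_mul_of_nonneg_left hlt.le hN0
    linarith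

/-- Outputs of the algorithm are locally minimal. -/
theorem CorrectionReturns.locally_minimal {k : ℤ} {q : ℝ} {f f' : Cochain F k}
    (h : CorrectionReturns w o F k q f f') (u : X) (hu0 : 0 ≤ fdim u) (huk : fdim u ≤ k) (j : ℤ)
    (hj : j = k - fdim u - 1) (g : Cochain (F.link u) j) :
    cnorm w (coboundary o F k (k + 1) f') - q * w u ≤
      cnorm w (coboundary o F k (k + 1) f' - coboundary o F k (k + 1) (extendZero u hj g)) := by
  subst hj
  by_contra! hlt
  refine h.2 ⟨_, u, hu0, huk, -g, ?_, rfl⟩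
  rwa [← extendZero_eq_extendLink, extendZero_neg, map_neg, ← sub_eq_add_neg]

/-- A cocycle that minimizes the norm in its cohomology class is locally minimal. -/
theorem exists_minimal_representative {k l : ℤ} (hl : l + 1 = k) {f : Cochain F k}
    (hf : f ∈ cocycles o F k) :
    ∃ f' ∈ cocycles o F k, f - f' ∈ LinearMap.range (coboundary o F l k) ∧
      cnorm w f' ≤ cnorm w f ∧
      ∀ h : Cochain F l, cnorm w f' ≤ cnorm w (f' - coboundary o F l k h) := by
  obtain ⟨f', ⟨h1, h2⟩, hmin⟩ := (wellFounded_cnorm_lt (F := F) w k).has_min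
    {g | g ∈ cocycles o F k ∧ f - g ∈ LinearMap.range (coboundary o F l k)}
    ⟨f, hf, by rw [sub_self]; exact Submodule.zero_mem _⟩
  refine ⟨f', h1, h2, not_lt.1 (hmin f ⟨hf, by rw [sub_self]; exact Submodule.zero_mem _⟩),
    fun h => not_lt.1 (hmin _ ⟨?_, ?_⟩)⟩
  · exact Submodule.sub_mem _ h1 (coboundary_mem_cocycles o hl.symm h)
  · have e : f - (f' - coboundary o F l k h) = (f - f') + coboundary o F l k h := by abel
    rw [e]
    exact Submodule.add_mem _ h2 ⟨h, rfl⟩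

end Algorithm

/-! ### Choice of constants and proof of the theorem. -/

theorem RelHypergraph.IsSkeletonExpander.mono {H : RelHypergraph.{uX}} {α α' β : ℝ}
    (h : H.IsSkeletonExpander α β) (hV : ∀ v, 0 ≤ H.wV v) (hα : α ≤ α') :
    H.IsSkeletonExpander α' β := fun A =>
  (h A).trans (by
    have := weightOf_nonneg hV A
    gcongr)

theorem mainTheorem8 (k : ℕ) :
    ∃ K K' : ℝ, 0 < K ∧ K ≤ 1 ∧ 0 < K' ∧ K' ≤ 1 ∧
      ∀ (R : Type uR) [CommRing R]
        (X : Type uX) [PartialOrder X] [OrderBot X] [Fintype X] [GradeOrder ℤ X]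
        (d : ℕ) (w : X → ℝ) (o : POrientation R X) (F : PosetSheaf.{uR, uX, uM} R X)
        (ε B' : ℝ),
        IsCubeComplex X → IsProperWeight d w → k + 2 ≤ d →
        0 < ε → ε ≤ 1 → 1 ≤ B' →
        -- local coboundary expansion, first range
        (∀ u : X, 0 ≤ fdim u → fdim u ≤ k →
          ENNReal.ofReal ε ≤
            cbe ((k : ℤ) - fdim u - 1) (linkWeight d w u) (o.link u) (F.link u)) →
        -- local coboundary expansion, second range
        (∀ u : X, 0 ≤ fdim u → fdim u ≤ k + 1 →
          ENNReal.ofReal ε ≤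
            cbe ((k : ℤ) - fdim u) (linkWeight d w u) (o.link u) (F.link u)) →
        -- expansion of the underlying graphs of the links
        (∀ u : X, -1 ≤ fdim u → fdim u ≤ k →
          (underlyingGraph (linkWeight d w u)).IsSkeletonExpander
            ((K * ε) ^ (2 ^ ((k : ℤ) - fdim u).toNat)) 1) →
        -- expansion of the hypergraphs of opposite faces
        (∀ i : ℕ, 1 ≤ i → i ≤ k + 1 →
          (noIntersection (i : ℤ) (i : ℤ) ((i : ℤ) + 1) w).IsSkeletonExpander
            ((K * ε) ^ (2 ^ (k + 1 - i)))
            (B' * ((K * ε) ^ (2 ^ (k + 2 - i) * (2 ^ i - 1)))⁻¹)) →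
        -- cosystolic expansion
        ENNReal.ofReal (B'⁻¹ * K' * (K * ε) ^ (2 ^ (k + 2) - 1)) ≤ cse (k : ℤ) w o F ∧
        -- cocycle distance
        ((∀ i : ℕ, 1 ≤ i → i ≤ k →
            (noIntersection (i : ℤ) (i : ℤ) ((i : ℤ) + 1) w).IsSkeletonExpander
              ((K * ε) ^ (2 ^ (k + 1 - i)))
              (B' * ((K * ε) ^ (2 ^ (k + 1 - i) * (2 ^ i - 1)))⁻¹)) →
          ENNReal.ofReal (B'⁻¹ * K' * (K * ε) ^ (2 ^ (k + 1) - 1)) ≤ ccd (k : ℤ) w o F) ∧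
        -- correction algorithm
        (∀ f : Cochain F (k : ℤ),
          cdist w f (cocycles o F (k : ℤ)) < B'⁻¹ * K' * (K * ε) ^ (2 ^ (k + 2) - 1) →
          CorrectionStops w o F (k : ℤ) (K * (K * ε) ^ (2 ^ (k + 1) - 1)) f ∧
          ∀ f' : Cochain F (k : ℤ),
            CorrectionReturns w o F (k : ℤ) (K * (K * ε) ^ (2 ^ (k + 1) - 1)) f f' →
            f' ∈ cocycles o F (k : ℤ) ∧
            cnorm w (f - f') ≤
              K'⁻¹ * ((K * ε) ^ (2 ^ (k + 1)))⁻¹ * cdist w f (cocycles o F (k : ℤ))) := by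
  -- N is the number of faces of a (k + 2)-cube, ∅ included, and bounds all face counts below.
  obtain ⟨N, hNdef⟩ : ∃ N : ℝ, N = 3 ^ (k + 2) + 1 := ⟨_, rfl⟩
  have hN1 : 1 ≤ N := by
    have : (0 : ℝ) ≤ 3 ^ (k + 2) := by positivity
    linarith
  have hN0 : 0 < N := by linarith
  have hNle : ∀ j ≤ k + 2, (3 : ℝ) ^ j + 1 ≤ N := by
    intro j hj
    have : (3 : ℝ) ^ j ≤ 3 ^ (k + 2) := pow_le_pow_right₀ (by norm_num) hj
    linarith
  -- In degree m = k + 1, this makes 8(m + 1)N^5 K equal to 1/2.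
  obtain ⟨K, hKdef⟩ : ∃ K : ℝ, K = 1 / (16 * (k + 2) * N ^ 5) := ⟨_, rfl⟩
  have hK0 : 0 < K := by rw [hKdef]; positivity
  have hKN : 16 * (k + 2) * N ^ 5 * K = 1 := by
    rw [hKdef]
    field_simp
  have hk0 : (0 : ℝ) ≤ k := Nat.cast_nonneg k
  have hKk : 16 * (k + 2) * K ≤ 1 := by
    rw [← hKN]
    have : (1 : ℝ) ≤ N ^ 5 := one_le_pow₀ hN1
    have h2 : 0 ≤ 16 * ((k : ℝ) + 2) * K := by positivity
    nlinarith
  have hK1 : K ≤ 1 := by nlinarith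
  have hN2 : 1 ≤ N ^ 2 := one_le_pow₀ hN1
  have hK' : K / N ^ 2 ≤ K := div_le_self hK0.le hN2
  have hK'1 : K / N ^ 2 ≤ 1 := hK'.trans hK1
  -- One factor N is from ‖df‖ ≤ N dist(f, Z^k), the other from q‖f - f'‖ ≤ N‖df‖.
  refine ⟨K, K / N ^ 2, hK0, hK1, by positivity, hK'1, ?_⟩
  intro R _ X _ _ _ _ d w o F ε B' hX hw hkd hε0 hε1 hB h1a h1b h2 h2NI
  obtain ⟨t, ht⟩ : ∃ t, t = K * ε := ⟨_, rfl⟩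
  rw [← ht] at h2 h2NI ⊢
  have ht0 : 0 < t := by rw [ht]; positivity
  have ht1 : t ≤ 1 := by rw [ht]; exact mul_le_one₀ hK1 hε0.le hε1
  have hB0 : 0 < B' := by linarith
  have hBinv : B'⁻¹ ≤ 1 := inv_le_one_of_one_le₀ hB
  have hnn := hw.nonneg
  set q := K * t ^ (2 ^ (k + 1) - 1) with hqdef
  have hq0 : 0 < q := by positivity
  set thr := B'⁻¹ * t ^ (2 ^ (k + 2) - 1) with hthr
  have hthr0 : 0 < thr := by positivity
  -- Both the cosystolic bound and the claim about the algorithm rest on this: df' is a small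
  -- locally minimal cocycle of degree k + 1, hence zero.
  have hout : ∀ f f' : Cochain F (k : ℤ), CorrectionReturns w o F (k : ℤ) q f f' →
      cnorm w (coboundary o F k (k + 1) f) < thr → f' ∈ cocycles o F (k : ℤ) ∧
        q * cnorm w (f - f') ≤ N * cnorm w (coboundary o F k (k + 1) f) := by
    intro f f' hret hsmall
    have hdiff := cnorm_sub_le_of_correction hw hX (by omega) hq0.le (hNle k (by omega)) hret.1
    have hn1 := cnorm_nonneg hnn (coboundary o F k (k + 1) f')
    have hn2 := cnorm_nonneg hnn (f - f')
    have hmono : cnorm w (coboundary o F k (k + 1) f') ≤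
        cnorm w (coboundary o F k (k + 1) f) := by
      have : 0 ≤ N * (cnorm w (coboundary o F k (k + 1) f) -
        cnorm w (coboundary o F k (k + 1) f')) := (mul_nonneg hq0.le hn2).trans hdiff
      have := nonneg_of_mul_nonneg_right this hN0
      linarith
    refine ⟨LinearMap.mem_ker.2 ?_, hdiff.trans (mul_le_mul_of_nonneg_left (by linarith) hN0.le)⟩
    refine eq_zero_of_locally_minimal (m := k + 1) (l := k) (o := o) hw hX (by omega)
      (by push_cast; rfl) rfl (N := N) (q := q) (B := B') (hNle _ (by omega)) hε0 hq0.le hB ht hK0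
      ?_ ht1 ?_ ?_ ?_ ?_ (coboundary_mem_cocycles o rfl f') (hmono.trans_lt hsmall)
      hret.locally_minimal
    · push_cast
      have e : 8 * ((k : ℝ) + 1 + 1) * N ^ 5 * K = 1 / 2 := by linarith
      rw [e]
      norm_num
    · rw [hqdef]
      push_cast
      have : 0 < t ^ (2 ^ (k + 1) - 1) := by positivity
      nlinarith
    · rintro u hu0 huk j rfl g
      have e : ((k + 1 : ℕ) : ℤ) - fdim u - 1 = (k : ℤ) - fdim u := by push_cast; ring
      revert g
      rw [e]
      exact mul_cdist_le_of_le_cbe (fun x => linkWeight_nonneg hw x)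
        (h1b u hu0 (by push_cast at huk; exact huk))
    · intro s hs z hz
      have := h2 z (by push_cast at hz; omega) (by push_cast at hz; omega)
      rwa [show ((k : ℤ) - fdim z).toNat = s by push_cast at hz; omega] at this
    · intro s hs
      have h := h2NI (k + 1 - s) (by omega) (by omega)
      have e1 : ((k + 1 - s : ℕ) : ℤ) = ((k + 1 : ℕ) : ℤ) - s := by omega
      have e2 : k + 1 - (k + 1 - s) = s := by omega
      have e3 : 2 ^ (k + 2 - (k + 1 - s)) * (2 ^ (k + 1 - s) - 1) =
          2 ^ (k + 1 + 1) - 2 ^ (s + 1) := by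
        rw [Nat.mul_sub, ← pow_add, mul_one, show k + 2 - (k + 1 - s) = s + 1 by omega,
          show s + 1 + (k + 1 - s) = k + 1 + 1 by omega]
      rwa [e1, e2, e3] at h
  refine ⟨?_, ?_, ?_⟩
  · refine ofReal_le_cse (by positivity) fun f => ?_
    have hμ : B'⁻¹ * (K / N ^ 2) * t ^ (2 ^ (k + 2) - 1) = K / N ^ 2 * thr := by rw [hthr]; ring
    rw [hμ]
    have hn := cnorm_nonneg hnn (coboundary o F k (k + 1) f)
    -- For small ‖df‖ the output of the algorithm is a cocycle near f. Otherwise the inequality is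
    -- trivial, as distances are at most 1.
    by_cases hsmall : cnorm w (coboundary o F k (k + 1) f) < thr
    · obtain ⟨f', hret⟩ := exists_correctionReturns (correctionStops (o := o) hnn hq0.le f)
      obtain ⟨hf', hdist⟩ := hout f f' hret hsmall
      have hd := cdist_le hnn f hf'
      have hq : K * thr ≤ q := by
        have e1 : t ^ (2 ^ (k + 2) - 1) ≤ t ^ (2 ^ (k + 1) - 1) :=
          pow_le_pow_of_le_one ht0.le ht1
            (Nat.sub_le_sub_right (Nat.pow_le_pow_right (by norm_num) (by omega)) 1)
        have e2 : thr ≤ t ^ (2 ^ (k + 2) - 1) := mul_le_of_le_one_left (by positivity) hBinv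
        exact mul_le_mul_of_nonneg_left (e2.trans e1) hK0.le
      have hn2 := cnorm_nonneg hnn (f - f')
      calc K / N ^ 2 * thr * cdist w f (cocycles o F k)
          ≤ K / N ^ 2 * thr * cnorm w (f - f') := by gcongr
        _ = K * thr * cnorm w (f - f') / N ^ 2 := by ring
        _ ≤ q * cnorm w (f - f') / N ^ 2 := by gcongr
        _ ≤ N * cnorm w (coboundary o F k (k + 1) f) / N ^ 2 := by gcongr
        _ = cnorm w (coboundary o F k (k + 1) f) / N := by field_simp
        _ ≤ _ := div_le_self hn hN1
    · push Not at hsmall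
      have hd : cdist w f (cocycles o F k) ≤ 1 := by
        refine (cdist_le hnn f (Submodule.zero_mem _)).trans ?_
        exact cnorm_le_one hw hX (by omega) _
      calc K / N ^ 2 * thr * cdist w f (cocycles o F k) ≤ K / N ^ 2 * thr * 1 := by gcongr
        _ ≤ 1 * thr * 1 := by gcongr
        _ ≤ _ := by linarith
  · intro h2NI'
    refine le_sInf ?_
    rintro _ ⟨f, hf, hfB, rfl⟩
    refine ENNReal.ofReal_le_ofReal ?_
    by_contra! hlt
    obtain ⟨f', hf', hff', hle, hmin⟩ :=
      exists_minimal_representative (w := w) (l := (k : ℤ) - 1) (by ring) hf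
    have hsmall : cnorm w f' < B'⁻¹ * t ^ (2 ^ (k + 1) - 1) := by
      refine (hle.trans_lt hlt).trans_le ?_
      gcongr
      exact mul_le_of_le_one_right (by positivity) hK'1
    -- The hypotheses are adjusted to degree k + 1. In degree k their first parameter is t^(2^(s +
    -- 1)), while t^(2^s) suffices.
    have hle2 : ∀ s : ℕ, t ^ (2 ^ (s + 1)) ≤ t ^ (2 ^ s) := fun s =>
      pow_le_pow_of_le_one ht0.le ht1 (Nat.pow_le_pow_right (by norm_num) (by omega))
    have hzero : f' = 0 := by
      -- The representative is minimal in its whole cohomology class, so no error is needed and q =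
      -- 0.
      refine eq_zero_of_locally_minimal (m := k) (l := (k : ℤ) - 1) (o := o) hw hX (by omega)
        rfl (by ring) (N := N) (q := 0) (B := B') (hNle _ (by omega)) hε0 le_rfl hB ht hK0
        ?_ ht1 ?_ ?_ ?_ ?_ hf' hsmall ?_
      · have e : 8 * ((k : ℝ) + 1) * N ^ 5 * K ≤ 8 * ((k : ℝ) + 2) * N ^ 5 * K := by
          gcongr
          norm_num
        linarith
      · rw [mul_zero]
        positivity
      · rintro u hu0 huk j rfl g
        exact mul_cdist_le_of_le_cbe (fun x => linkWeight_nonneg hw x) (h1a u hu0 huk) g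
      · intro s hs z hz
        have := h2 z (by omega) (by omega)
        rw [show ((k : ℤ) - fdim z).toNat = s + 1 by omega] at this
        exact this.mono (fun v => linkWeight_nonneg hw _) (hle2 s)
      · intro s hs
        have h := h2NI' (k - s) (by omega) (by omega)
        have e1 : ((k - s : ℕ) : ℤ) = (k : ℤ) - s := by omega
        have e2 : k + 1 - (k - s) = s + 1 := by omega
        have e3 : 2 ^ (s + 1) * (2 ^ (k - s) - 1) = 2 ^ (k + 1) - 2 ^ (s + 1) := by
          rw [Nat.mul_sub, ← pow_add, mul_one, show s + 1 + (k - s) = k + 1 by omega]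
        rw [e1, e2, e3] at h
        refine h.mono (fun v => ?_) (hle2 s)
        show 0 ≤ if (k : ℤ) - s = (k : ℤ) - s then w v.1 else w v.1 / 2
        rw [if_pos rfl]
        exact hnn _
      · intro u _ _ j hj g
        rw [zero_mul, sub_zero]
        exact hmin _
    rw [hzero, sub_zero] at hff'
    exact hfB hff'
  · intro f hdist
    refine ⟨correctionStops hnn hq0.le f, fun f' hret => ?_⟩
    have hD0 : 0 ≤ cdist w f (cocycles o F k) := le_cdist fun g _ => cnorm_nonneg hnn _
    -- Subtracting a cocycle from f does not change df.
    have hdf : cnorm w (coboundary o F k (k + 1) f) ≤ N * cdist w f (cocycles o F k) := by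
      rw [← div_le_iff₀' hN0]
      refine le_cdist fun g hg => ?_
      rw [div_le_iff₀' hN0]
      have e : coboundary o F k (k + 1) f = coboundary o F k (k + 1) (f - g) := by
        rw [map_sub, LinearMap.mem_ker.1 hg, sub_zero]
      rw [e]
      refine (cnorm_coboundary_le hw hX (m := k + 1) (by push_cast; rfl) (by omega) (by omega)
        _).trans (mul_le_mul_of_nonneg_right (le_trans ?_ (hNle (k + 1) (by omega)))
          (cnorm_nonneg hnn _))
      exact_mod_cast cubeCount_le _ _
    have hsmall : cnorm w (coboundary o F k (k + 1) f) < thr := by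
      refine hdf.trans_lt ?_
      have h1 : N * cdist w f (cocycles o F k) < N * (K / N ^ 2 * thr) := by
        refine mul_lt_mul_of_pos_left (hdist.trans_eq ?_) hN0
        rw [hthr]
        ring
      refine h1.trans_le ?_
      calc N * (K / N ^ 2 * thr) = K / N * thr := by field_simp
        _ ≤ 1 * thr := by
            gcongr
            exact (div_le_self hK0.le hN1).trans hK1
        _ = thr := one_mul _
    obtain ⟨hf', hd⟩ := hout f f' hret hsmall
    refine ⟨hf', ?_⟩
    have hT : 0 < t ^ (2 ^ (k + 1)) := by positivity
    -- One power of t is given away, to reach the exponent of the stated bound.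
    have hq : K * t ^ (2 ^ (k + 1)) ≤ q :=
      mul_le_mul_of_nonneg_left (pow_le_pow_of_le_one ht0.le ht1 (Nat.sub_le _ _)) hK0.le
    have hn := cnorm_nonneg hnn (f - f')
    have h3 : K * t ^ (2 ^ (k + 1)) * cnorm w (f - f') ≤ N ^ 2 * cdist w f (cocycles o F k) := by
      calc _ ≤ q * cnorm w (f - f') := by gcongr
        _ ≤ N * (N * cdist w f (cocycles o F k)) := hd.trans (by gcongr)
        _ = _ := by ring
    calc cnorm w (f - f') ≤ N ^ 2 * cdist w f (cocycles o F k) / (K * t ^ (2 ^ (k + 1))) := by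
          rw [le_div_iff₀ (by positivity), mul_comm]
          exact h3
      _ = _ := by
          field_simp
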